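/- **Setting.** Let $d\ge 1$, $\mathcal S=\{s\in[0,1]^d:\|s\|_1\le 1\}$ and $\mathrm{Int}(\mathcal S)=\{s\in(0,1)^d:\|s\|_1<1\}$, where $\|s\|_1=\sum_{i=1}^d|s_i|$. For $\alpha\in(0,\infty)^d$ and $\beta>0$ let $$K_{\alpha,\beta}(x)=\frac{\Gamma(\|\alpha\|_1+\beta)}{\Gamma(\beta)\prod_{i=1}^d\Gamma(\alpha_i)}\,(1-\|x\|_1)^{\beta-1}\prod_{i=1}^d x_i^{\alpha_i-1},\qquad x\in\mathcal S,$$ be the Dirichlet density. Let $X_1,\dots,X_n$ be i.i.d. random vectors with a density $f$ supported on $\mathcal S$ and, for $b>0$, let $$\hat f_{n,b}(s)=\frac1n\sum_{i=1}^n K_{s/b+1,\,(1-\|s\|_1)/b+1}(X_i),\qquad s\in\mathcal S.$$ Put $\mathrm{Bias}[\hat f_{n,b}(s)]=\mathbb E[\hat f_{n,b}(s)]-f(s)$ and $\mathrm{MSE}[\hat f_{n,b}(s)]=\mathbb E\big[|\hat f_{n,b}(s)-f(s)|^2\big]$, and, for $s\in\mathrm{Int}(\mathcal S)$, $$\psi(s)=\Big[(4\pi)^d(1-\|s\|_1)\prod_{i=1}^d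 s_i\Big]^{-1/2},$$ $$g(s)=\sum_{i=1}^d\big(1-(d+1)s_i\big)\frac{\partial f}{\partial s_i}(s)+\frac12\sum_{i,j=1}^d s_i\big(\mathbf 1_{\{i=j\}}-s_j\big)\frac{\partial^2 f}{\partial s_i\partial s_j}(s).$$ **Corollary (Mean squared error).** Assume that $f$ is twice continuously differentiable on $\mathcal S$. Throughout, $s\in\mathrm{Int}(\mathcal S)$. For all $n\ge1$ and $b>0$, $\hat f_{n,b}(s)$ is square integrable, its MSE depends on the sample only through its size $n$ and the density $f$, and $$\mathrm{MSE}[\hat f_{n,b}(s)]=\mathrm{Var}(\hat f_{n,b}(s))+\big(\mathrm{Bias}[\hat f_{n,b}(s)]\big)^2 .$$ 1. As $n\to\infty$ and $b\to0^+$ (jointly), $$\mathrm{MSE}[\hat f_{n,b}(s)]=n^{-1}b^{-d/2}\psi(s)f(s)+b^2g(s)^2+\mathcal O_s\big(n^{-1}b^{-d/2+1/2}\big)+o(b^2),$$ where the constant in $\mathcal O_s$ depends only on $d$, $f$ and $s$, and the $o(b^2)$ term is uniform in $s\in\mathrm{Int}(\mathcal S)$. 2. If $f(s)g(s)\ne0$,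 then the asymptotically optimal bandwidth with respect to the MSE at $s$ is $$b_{\mathrm{opt}}(s)=n^{-2/(d+4)}\Big[\frac d4\cdot\frac{\psi(s)f(s)}{g(s)^2}\Big]^{2/(d+4)}$$ in the following sense: for every $n\ge1$ it is the unique minimiser over $b>0$ of the leading part $n^{-1}b^{-d/2}\psi(s)f(s)+b^2g(s)^2$; and for every $\varepsilon>0$ there are $n_0\in\mathbb N$ and $b_0>0$ such that $(1-\varepsilon)\,\mathrm{MSE}[\hat f_{n,b_{\mathrm{opt}}(s)}(s)]\le\mathrm{MSE}[\hat f_{n,b}(s)]$ for all $n\ge n_0$ and $0<b<b_0$. Moreover, as $n\to\infty$, $$\mathrm{MSE}[\hat f_{n,b_{\mathrm{opt}}(s)}(s)]=n^{-4/(d+4)}\left[\frac{1+\frac d4}{(\frac d4)^{d/(d+4)}}\right]\frac{(\psi(s)f(s))^{4/(d+4)}}{(g(s)^2)^{-d/(d+4)}}+o_s\big(n^{-4/(d+4)}\big).$$ 3. If $b=b(n)>0$ satisfies $n^{2/(d+4)}\,b\to\lambda$ for some $\lambda>0$, then, as $n\to\infty$, $$\mathrm{MSE}[\hat f_{n,b}(s)]=n^{-4/(d+4)}\big[\lambda^{-d/2}\psi(s)f(s)+\lambda^2g(s)^2\big]+o_s\big(n^{-4/(d+4)}\big).$$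 -/

import Mathlib

open Filter Topology Asymptotics MeasureTheory ProbabilityTheory

namespace DirichletKernel

noncomputable section

/-- The norm `‖s‖₁ = ∑ |s i|`. -/
def l1Norm {d : ℕ} (s : Fin d → ℝ) : ℝ := ∑ i, |s i|

/-- The `d`-dimensional simplex `𝒮 = {s ∈ [0,1]^d : ‖s‖₁ ≤ 1}`. -/
def simplex (d : ℕ) : Set (Fin d → ℝ) :=
  {s | (∀ i, s i ∈ Set.Icc (0 : ℝ) 1) ∧ l1Norm s ≤ 1}

/-- Its interior `{s ∈ (0,1)^d : ‖s‖₁ < 1}`. -/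
def simplexInt (d : ℕ) : Set (Fin d → ℝ) :=
  {s | (∀ i, s i ∈ Set.Ioo (0 : ℝ) 1) ∧ l1Norm s < 1}

/-- The density `K_{α,β}` of the Dirichlet distribution on the simplex. It is only ever evaluated
(almost surely) at points of the simplex. -/
def dirichletDensity {d : ℕ} (α : Fin d → ℝ) (β : ℝ) (x : Fin d → ℝ) : ℝ :=
  Real.Gamma (l1Norm α + β) / (Real.Gamma β * ∏ i, Real.Gamma (α i)) *
    ((1 - l1Norm x) ^ (β - 1) * ∏ i, x i ^ (α i - 1))

/-- The kernel `K_{s/b + 1, (1 - ‖s‖₁)/b + 1}`. -/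
def kernel {d : ℕ} (b : ℝ) (s : Fin d → ℝ) : (Fin d → ℝ) → ℝ :=
  dirichletDensity (fun i => s i / b + 1) ((1 - l1Norm s) / b + 1)

/-- The Dirichlet kernel estimator `f̂_{n,b}(s)` built on a sample `X₁, …, Xₙ`, as a random
variable. -/
def estimator {d n : ℕ} {Ω : Type*} (X : Fin n → Ω → (Fin d → ℝ)) (b : ℝ) (s : Fin d → ℝ) :
    Ω → ℝ :=
  fun ω => (1 / (n : ℝ)) * ∑ i, kernel b s (X i ω)

/-- `f` is a probability density on the simplex (values of `f` off the simplex are irrelevant). -/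
structure IsSimplexDensity {d : ℕ} (f : (Fin d → ℝ) → ℝ) : Prop where
  nonneg : ∀ x ∈ simplex d, 0 ≤ f x
  integrableOn : IntegrableOn f (simplex d)
  integral_eq_one : ∫ x in simplex d, f x = 1

/-- The distribution on the simplex with Lebesgue density `f`. -/
def simplexLaw {d : ℕ} (f : (Fin d → ℝ) → ℝ) : Measure (Fin d → ℝ) :=
  (volume.restrict (simplex d)).withDensity (fun x => ENNReal.ofReal (f x))

/-- `X₁, …, Xₙ` are i.i.d. random vectors on `(Ω, P)` with density `f` supported on the simplex. -/
structure IsSample {d n : ℕ} {Ω : Type*} [MeasurableSpace Ω] (P : Measure Ω)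
    (f : (Fin d → ℝ) → ℝ) (X : Fin n → Ω → (Fin d → ℝ)) : Prop where
  hasLaw : ∀ i, HasLaw (X i) (simplexLaw f) P
  indep : iIndepFun X P

/-- `Bias[f̂_{n,b}(s)] = E[f̂_{n,b}(s)] - f(s)`. -/
def bias {d n : ℕ} {Ω : Type*} [MeasurableSpace Ω] (P : Measure Ω) (f : (Fin d → ℝ) → ℝ)
    (X : Fin n → Ω → (Fin d → ℝ)) (b : ℝ) (s : Fin d → ℝ) : ℝ :=
  (∫ ω, estimator X b s ω ∂P) - f s

/-- `MSE[f̂_{n,b}(s)] = E[|f̂_{n,b}(s) - f(s)|²]`. -/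
def meanSquaredError {d n : ℕ} {Ω : Type*} [MeasurableSpace Ω] (P : Measure Ω)
    (f : (Fin d → ℝ) → ℝ) (X : Fin n → Ω → (Fin d → ℝ)) (b : ℝ) (s : Fin d → ℝ) : ℝ :=
  ∫ ω, |estimator X b s ω - f s| ^ 2 ∂P

/-- `ψ(s) = [(4π)^d (1 - ‖s‖₁) ∏ s_i]^{-1/2}`. -/
def psi {d : ℕ} (s : Fin d → ℝ) : ℝ :=
  ((4 * Real.pi) ^ d * (1 - l1Norm s) * ∏ i, s i) ^ (-(1 / 2) : ℝ)

/-- The partial derivative `∂f/∂s_i` (used at interior points of the simplex, where the functions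
concerned are differentiable). -/
def partialDeriv {d : ℕ} (i : Fin d) (f : (Fin d → ℝ) → ℝ) (s : Fin d → ℝ) : ℝ :=
  fderiv ℝ f s (Pi.single i 1)

/-- `g(s) = ∑ᵢ (1 - (d+1) sᵢ) ∂ᵢf(s) + ½ ∑ᵢⱼ sᵢ (1_{i=j} - sⱼ) ∂ᵢ∂ⱼf(s)`. -/
def gTerm {d : ℕ} (f : (Fin d → ℝ) → ℝ) (s : Fin d → ℝ) : ℝ :=
  ∑ i, (1 - ((d : ℝ) + 1) * s i) * partialDeriv i f s +
    (1 / 2) * ∑ i, ∑ j, s i * ((if i = j then 1 else 0) - s j) *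
      partialDeriv i (partialDeriv j f) s

/-- The leading part `n⁻¹ b^{-d/2} ψ(s) f(s) + b² g(s)²` of the mean squared error. -/
def leadingMSE {d : ℕ} (f : (Fin d → ℝ) → ℝ) (s : Fin d → ℝ) (n : ℕ) (b : ℝ) : ℝ :=
  (n : ℝ)⁻¹ * b ^ (-(d : ℝ) / 2) * (psi s * f s) + b ^ 2 * gTerm f s ^ 2

/-- `b_opt(s) = n^{-2/(d+4)} [(d/4) ψ(s) f(s) / g(s)²]^{2/(d+4)}`. -/
def bOpt {d : ℕ} (f : (Fin d → ℝ) → ℝ) (s : Fin d → ℝ) (n : ℕ) : ℝ :=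
  (n : ℝ) ^ (-2 / ((d : ℝ) + 4)) *
    ((d : ℝ) / 4 * (psi s * f s / gTerm f s ^ 2)) ^ (2 / ((d : ℝ) + 4))

end

end DirichletKernel

/-! `kernel b s` is the density of a Dirichlet vector with mean `s + b (1 - (d + 1) s) + O(b²)` and
covariance `b sᵢ (1_{i = j} - sⱼ) + O(b²)`. Integrating the second order Taylor expansion
of `f` at `s` against it gives the bias `b g(s) + o(b)`, uniformly in `s`, since the second
derivative of `f` is uniformly continuous on the simplex.

The square of `kernel b s` is a multiple of `kernel (b / 2) s`, so the second moment of the kernel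
is again a kernel mean. The factor is a quotient of Gamma functions, which Wallis-type bounds for
`Γ(x + 1/2) / Γ(x)` show to be `b^{-d/2} ψ(s) (1 + O(b))`.

The substitution `b = n^{-2/(d+4)} u` turns the leading part of the mean squared error into
`n^{-4/(d+4)} (u^{-d/2} A + u² G)`, where `A = ψ(s) f(s)` and `G = g(s)²`. This reduces the choice
of the bandwidth to a minimisation over `u`.
-/

namespace DirichletKernel

section Simplex

variable {d : ℕ} {s x : Fin d → ℝ}

lemma l1Norm_nonneg (x : Fin d → ℝ) : 0 ≤ l1Norm x :=
  Finset.sum_nonneg fun _ _ => abs_nonneg _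

lemma l1Norm_of_nonneg (hx : ∀ i, 0 ≤ x i) : l1Norm x = ∑ i, x i :=
  Finset.sum_congr rfl fun i _ => abs_of_nonneg (hx i)

@[fun_prop]
lemma continuous_l1Norm (d : ℕ) : Continuous (l1Norm : (Fin d → ℝ) → ℝ) := by
  unfold l1Norm
  fun_prop

/-- The simplex `{x ∈ [0,∞)^d : ∑ x i ≤ t}` of size `t`. The size is a parameter because the slices
of a simplex by a coordinate are smaller simplices. -/
def scaledSimplex (d : ℕ) (t : ℝ) : Set (Fin d → ℝ) := {x | (∀ i, 0 ≤ x i) ∧ ∑ i, x i ≤ t}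

lemma measurableSet_scaledSimplex (d : ℕ) (t : ℝ) : MeasurableSet (scaledSimplex d t) := by
  unfold scaledSimplex
  measurability

lemma cons_mem_scaledSimplex_iff {t x₀ : ℝ} :
    (Fin.cons x₀ x : Fin (d + 1) → ℝ) ∈ scaledSimplex (d + 1) t ↔
      x₀ ∈ Set.Icc 0 t ∧ x ∈ scaledSimplex d (t - x₀) := by
  simp only [scaledSimplex, Set.mem_ofPred_eq, Fin.forall_fin_succ, Fin.sum_univ_succ,
    Fin.cons_zero, Fin.cons_succ, Set.mem_Icc]
  constructor
  · rintro ⟨⟨hx₀, hx⟩, hsum⟩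
    exact ⟨⟨hx₀, by linarith [Finset.sum_nonneg fun i (_ : i ∈ Finset.univ) => hx i]⟩, hx,
      by linarith⟩
  · rintro ⟨⟨hx₀, _⟩, hx, hsum⟩
    exact ⟨⟨hx₀, hx⟩, by linarith⟩

lemma simplex_eq_scaledSimplex (d : ℕ) : simplex d = scaledSimplex d 1 := by
  ext x
  constructor
  · rintro ⟨hx, hsum⟩
    exact ⟨fun i => (hx i).1, by rwa [← l1Norm_of_nonneg fun i => (hx i).1]⟩
  · rintro ⟨hx, hsum⟩
    refine ⟨fun i => ⟨hx i, ?_⟩, by rwa [l1Norm_of_nonneg hx]⟩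
    exact (Finset.single_le_sum (fun j _ => hx j) (Finset.mem_univ i)).trans hsum

lemma measurableSet_simplex (d : ℕ) : MeasurableSet (simplex d) :=
  simplex_eq_scaledSimplex d ▸ measurableSet_scaledSimplex d 1

lemma nonneg_of_mem_simplex (hx : x ∈ simplex d) (i : Fin d) : 0 ≤ x i :=
  (hx.1 i).1

lemma isCompact_simplex (d : ℕ) : IsCompact (simplex d) := by
  have hcube : IsCompact (Set.pi Set.univ fun _ : Fin d => Set.Icc (0 : ℝ) 1) :=
    isCompact_univ_pi fun _ => isCompact_Icc
  have hball : IsClosed {x : Fin d → ℝ | l1Norm x ≤ 1} :=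
    isClosed_le (continuous_l1Norm d) continuous_const
  convert hcube.inter_right hball using 1
  ext x
  simp only [simplex, Set.mem_ofPred_eq, Set.mem_inter_iff, Set.mem_univ_pi]

lemma convex_simplex (d : ℕ) : Convex ℝ (simplex d) := by
  rw [simplex_eq_scaledSimplex]
  rintro x ⟨hx, hxsum⟩ y ⟨hy, hysum⟩ a b ha hb hab
  refine ⟨fun i => add_nonneg (mul_nonneg ha (hx i)) (mul_nonneg hb (hy i)), ?_⟩
  simp only [Pi.add_apply, Pi.smul_apply, smul_eq_mul, Finset.sum_add_distrib, ← Finset.mul_sum]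
  calc a * ∑ i, x i + b * ∑ i, y i ≤ a * 1 + b * 1 := by gcongr
    _ = 1 := by rw [mul_one, mul_one, hab]

lemma isOpen_simplexInt (d : ℕ) : IsOpen (simplexInt d) := by
  have hcube : IsOpen (Set.pi Set.univ fun _ : Fin d => Set.Ioo (0 : ℝ) 1) :=
    isOpen_set_pi Set.finite_univ fun _ _ => isOpen_Ioo
  have hball : IsOpen {x : Fin d → ℝ | l1Norm x < 1} :=
    isOpen_lt (continuous_l1Norm d) continuous_const
  convert hcube.inter hball using 1
  ext x
  simp only [simplexInt, Set.mem_ofPred_eq, Set.mem_inter_iff, Set.mem_univ_pi]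

lemma simplexInt_subset_simplex (d : ℕ) : simplexInt d ⊆ simplex d :=
  fun _ hx => ⟨fun i => ⟨(hx.1 i).1.le, (hx.1 i).2.le⟩, hx.2.le⟩

lemma simplexInt_nonempty (d : ℕ) : (simplexInt d).Nonempty := by
  refine ⟨fun _ => 1 / (d + 2 : ℝ), fun _ => ⟨by positivity, ?_⟩, ?_⟩
  · rw [div_lt_one (by positivity)]
    linarith [Nat.cast_nonneg (α := ℝ) d]
  · rw [l1Norm_of_nonneg fun _ => by positivity, Fin.sum_const, nsmul_eq_mul, mul_one_div,
      div_lt_one (by positivity)]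
    linarith

lemma simplex_mem_nhds (hs : s ∈ simplexInt d) : simplex d ∈ 𝓝 s :=
  mem_of_superset ((isOpen_simplexInt d).mem_nhds hs) (simplexInt_subset_simplex d)

lemma one_sub_l1Norm_pos (hs : s ∈ simplexInt d) : 0 < 1 - l1Norm s := sub_pos.2 hs.2

end Simplex

section DirichletIntegral

variable {d : ℕ} {α : Fin d → ℝ} {β t : ℝ}

lemma lintegral_rpow_mul_sub_rpow {a c t : ℝ} (ha : 0 < a) (hc : 0 < c) (ht : 0 < t) :
    ∫⁻ x in Set.Icc 0 t, ENNReal.ofReal (x ^ (a - 1) * (t - x) ^ (c - 1)) =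
      ENNReal.ofReal (beta a c * t ^ (a + c - 1)) := by
  have hbeta := beta_pos ha hc
  have himage : (fun x : ℝ => t * x) '' Set.Ioo 0 1 = Set.Ioo 0 t := by
    rw [Set.image_mul_left_Ioo ht, mul_zero, mul_one]
  have hunit := lintegral_betaPDF_eq_one ha hc
  rw [lintegral_betaPDF] at hunit
  have hscale : ∀ x ∈ Set.Ioo (0 : ℝ) 1,
      ENNReal.ofReal |t| * ENNReal.ofReal ((t * x) ^ (a - 1) * (t - t * x) ^ (c - 1)) =
        ENNReal.ofReal (beta a c * t ^ (a + c - 1)) *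
          ENNReal.ofReal (1 / beta a c * x ^ (a - 1) * (1 - x) ^ (c - 1)) := by
    intro x hx
    have hx1 : 0 ≤ 1 - x := by linarith [hx.2]
    rw [← ENNReal.ofReal_mul (abs_nonneg _), ← ENNReal.ofReal_mul (by positivity),
      show t - t * x = t * (1 - x) by ring, Real.mul_rpow ht.le hx.1.le, Real.mul_rpow ht.le hx1,
      show a + c - 1 = 1 + (a - 1) + (c - 1) by ring, Real.rpow_add ht, Real.rpow_add ht,
      Real.rpow_one, abs_of_pos ht]
    congr 1
    field_simp
  rw [← setLIntegral_congr (Ioo_ae_eq_Icc (μ := volume) (a := (0 : ℝ)) (b := t)), ← himage,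
    lintegral_image_eq_lintegral_abs_deriv_mul (f' := fun _ => t) measurableSet_Ioo
      (fun x _ => by simpa using ((hasDerivAt_id x).const_mul t).hasDerivWithinAt)
      (fun x _ y _ h => mul_left_cancel₀ ht.ne' h),
    setLIntegral_congr_fun measurableSet_Ioo hscale, lintegral_const_mul _ (by fun_prop), hunit,
    mul_one]

/-- The normalising constant of the Dirichlet density with parameters `(α, β)`. -/
noncomputable def dirichletConst (α : Fin d → ℝ) (β : ℝ) : ℝ :=
  Real.Gamma (l1Norm α + β) / (Real.Gamma β * ∏ i, Real.Gamma (α i))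

lemma dirichletConst_pos (hα : ∀ i, 0 < α i) (hβ : 0 < β) : 0 < dirichletConst α β :=
  div_pos (Real.Gamma_pos_of_pos (by linarith [l1Norm_nonneg α])) (mul_pos
    (Real.Gamma_pos_of_pos hβ) (Finset.prod_pos fun i _ => Real.Gamma_pos_of_pos (hα i)))

lemma inv_dirichletConst_succ {α : Fin (d + 1) → ℝ} (hα : ∀ i, 0 < α i) (hβ : 0 < β) :
    (dirichletConst α β)⁻¹ =
      (dirichletConst (Fin.tail α) β)⁻¹ * beta (α 0) (l1Norm (Fin.tail α) + β) := by
  have hsum : l1Norm α + β = α 0 + (l1Norm (Fin.tail α) + β) := by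
    rw [l1Norm, Fin.sum_univ_succ, abs_of_pos (hα 0), add_assoc]
    rfl
  have hΓ : 0 < Real.Gamma (l1Norm (Fin.tail α) + β) :=
    Real.Gamma_pos_of_pos (by linarith [l1Norm_nonneg (Fin.tail α)])
  have htail : ∏ i, Real.Gamma (Fin.tail α i) = ∏ i : Fin d, Real.Gamma (α i.succ) := rfl
  rw [dirichletConst, dirichletConst, hsum, Fin.prod_univ_succ, htail, beta, inv_div, inv_div]
  field_simp

/-- The unnormalised Dirichlet density on the simplex of size `t`, extended by zero. -/
noncomputable def dirichletWeight (α : Fin d → ℝ) (β t : ℝ) : (Fin d → ℝ) → ENNReal :=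
  (scaledSimplex d t).indicator fun x =>
    ENNReal.ofReal ((t - ∑ i, x i) ^ (β - 1) * ∏ i, x i ^ (α i - 1))

lemma measurable_dirichletWeight (α : Fin d → ℝ) (β t : ℝ) : Measurable (dirichletWeight α β t) :=
  Measurable.indicator (by fun_prop) (measurableSet_scaledSimplex d t)

lemma dirichletWeight_cons (α : Fin (d + 1) → ℝ) (β t x₀ : ℝ) (x : Fin d → ℝ) :
    dirichletWeight α β t (Fin.cons x₀ x) =
      (Set.Icc 0 t).indicator (fun x₀ => ENNReal.ofReal (x₀ ^ (α 0 - 1))) x₀ *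
        dirichletWeight (Fin.tail α) β (t - x₀) x := by
  unfold dirichletWeight
  by_cases hx₀ : x₀ ∈ Set.Icc 0 t
  · by_cases hx : x ∈ scaledSimplex d (t - x₀)
    · rw [Set.indicator_of_mem (cons_mem_scaledSimplex_iff.2 ⟨hx₀, hx⟩), Set.indicator_of_mem hx₀,
        Set.indicator_of_mem hx, ← ENNReal.ofReal_mul (Real.rpow_nonneg hx₀.1 _)]
      simp only [Fin.sum_univ_succ, Fin.prod_univ_succ, Fin.cons_zero, Fin.cons_succ, sub_sub,
        Fin.tail]
      congr 1
      ring
    · rw [Set.indicator_of_notMem fun h => hx (cons_mem_scaledSimplex_iff.1 h).2,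
        Set.indicator_of_notMem hx, mul_zero]
  · rw [Set.indicator_of_notMem fun h => hx₀ (cons_mem_scaledSimplex_iff.1 h).1,
      Set.indicator_of_notMem hx₀, zero_mul]

lemma lintegral_dirichletWeight_succ (α : Fin (d + 1) → ℝ) (β t : ℝ) :
    ∫⁻ x, dirichletWeight α β t x =
      ∫⁻ x₀ in Set.Icc 0 t, ENNReal.ofReal (x₀ ^ (α 0 - 1)) *
        ∫⁻ x, dirichletWeight (Fin.tail α) β (t - x₀) x := by
  let e := MeasurableEquiv.piFinSuccAbove (fun _ : Fin (d + 1) => ℝ) 0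
  have he : ∀ p : ℝ × (Fin d → ℝ), e.symm p = Fin.cons p.1 p.2 := fun p => by
    simp [e, MeasurableEquiv.piFinSuccAbove, Fin.insertNthEquiv]
  have hmp := (volume_preserving_piFinSuccAbove (fun _ : Fin (d + 1) => ℝ) 0).symm
  have hmeas := measurable_dirichletWeight α β t
  calc ∫⁻ x, dirichletWeight α β t x
      = ∫⁻ p : ℝ × (Fin d → ℝ), dirichletWeight α β t (e.symm p) := (hmp.lintegral_comp hmeas).symm
    _ = ∫⁻ x₀, ∫⁻ x, dirichletWeight α β t (e.symm (x₀, x)) := by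
        rw [Measure.volume_eq_prod, lintegral_prod
          (fun p : ℝ × (Fin d → ℝ) => dirichletWeight α β t (e.symm p))
          (hmeas.comp e.symm.measurable).aemeasurable]
    _ = _ := by
        rw [← lintegral_indicator measurableSet_Icc]
        refine lintegral_congr fun x₀ => ?_
        simp_rw [he, dirichletWeight_cons]
        rw [lintegral_const_mul _ (measurable_dirichletWeight _ _ _), Set.indicator_mul_left]

lemma lintegral_dirichletWeight (hα : ∀ i, 0 < α i) (hβ : 0 < β) (ht : 0 < t) :
    ∫⁻ x, dirichletWeight α β t x =
      ENNReal.ofReal ((dirichletConst α β)⁻¹ * t ^ (l1Norm α + β - 1)) := by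
  induction d generalizing t with
  | zero =>
    have huniv : scaledSimplex 0 t = Set.univ := by
      ext x
      simp [scaledSimplex, ht.le]
    simp [dirichletWeight, huniv, lintegral_unique, volume_pi, dirichletConst, l1Norm,
      (Real.Gamma_pos_of_pos hβ).ne']
  | succ d ih =>
    have hα' : ∀ i, 0 < Fin.tail α i := fun i => hα _
    have hc := (inv_pos.2 (dirichletConst_pos hα' hβ)).le
    have hpos : 0 < l1Norm (Fin.tail α) + β := by linarith [l1Norm_nonneg (Fin.tail α)]
    have hslice : ∀ᵐ x₀ : ℝ, x₀ ∈ Set.Icc 0 t →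
        ENNReal.ofReal (x₀ ^ (α 0 - 1)) * ∫⁻ x, dirichletWeight (Fin.tail α) β (t - x₀) x =
          ENNReal.ofReal (dirichletConst (Fin.tail α) β)⁻¹ *
            ENNReal.ofReal (x₀ ^ (α 0 - 1) * (t - x₀) ^ (l1Norm (Fin.tail α) + β - 1)) := by
      filter_upwards [Measure.ae_ne volume t] with x₀ hne hx₀
      rw [ih hα' (sub_pos.2 (lt_of_le_of_ne hx₀.2 hne)),
        ← ENNReal.ofReal_mul (Real.rpow_nonneg hx₀.1 _), ← ENNReal.ofReal_mul hc, mul_left_comm]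
    have hsum : α 0 + (l1Norm (Fin.tail α) + β) = l1Norm α + β := by
      rw [l1Norm, l1Norm, Fin.sum_univ_succ, abs_of_pos (hα 0), add_assoc]
      rfl
    rw [lintegral_dirichletWeight_succ, setLIntegral_congr_fun_ae measurableSet_Icc hslice,
      lintegral_const_mul _ (by fun_prop), lintegral_rpow_mul_sub_rpow (hα 0) hpos ht,
      ← ENNReal.ofReal_mul hc, hsum, inv_dirichletConst_succ hα hβ, mul_assoc]

end DirichletIntegral

section DirichletDensity

variable {d : ℕ} {α : Fin d → ℝ} {β : ℝ} {x : Fin d → ℝ}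

@[fun_prop]
lemma measurable_dirichletDensity (α : Fin d → ℝ) (β : ℝ) :
    Measurable (dirichletDensity α β) := by
  unfold dirichletDensity
  fun_prop

lemma dirichletDensity_eq (α : Fin d → ℝ) (β : ℝ) (x : Fin d → ℝ) :
    dirichletDensity α β x =
      dirichletConst α β * ((1 - l1Norm x) ^ (β - 1) * ∏ i, x i ^ (α i - 1)) := rfl

lemma dirichletDensity_nonneg (hα : ∀ i, 0 < α i) (hβ : 0 < β) (hx : x ∈ simplex d) :
    0 ≤ dirichletDensity α β x :=
  mul_nonneg (dirichletConst_pos hα hβ).le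
    (mul_nonneg (Real.rpow_nonneg (sub_nonneg.2 hx.2) _)
      (Finset.prod_nonneg fun i _ => Real.rpow_nonneg (nonneg_of_mem_simplex hx i) _))

lemma ae_dirichletDensity_nonneg (hα : ∀ i, 0 < α i) (hβ : 0 < β) :
    0 ≤ᵐ[volume.restrict (simplex d)] dirichletDensity α β :=
  (ae_restrict_iff' (measurableSet_simplex d)).2
    (ae_of_all _ fun _ hx => dirichletDensity_nonneg hα hβ hx)

lemma lintegral_dirichletDensity (hα : ∀ i, 0 < α i) (hβ : 0 < β) :
    ∫⁻ x in simplex d, ENNReal.ofReal (dirichletDensity α β x) = 1 := by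
  have hc := dirichletConst_pos hα hβ
  have hweight : (simplex d).indicator (fun x => ENNReal.ofReal (dirichletDensity α β x)) =
      fun x => ENNReal.ofReal (dirichletConst α β) * dirichletWeight α β 1 x := by
    rw [simplex_eq_scaledSimplex]
    ext x
    by_cases hx : x ∈ scaledSimplex d 1
    · rw [dirichletWeight, Set.indicator_of_mem hx, Set.indicator_of_mem hx,
        ← ENNReal.ofReal_mul hc.le, dirichletDensity_eq, l1Norm_of_nonneg hx.1]
    · rw [dirichletWeight, Set.indicator_of_notMem hx, Set.indicator_of_notMem hx, mul_zero]
  rw [← lintegral_indicator (measurableSet_simplex d), hweight,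
    lintegral_const_mul _ (measurable_dirichletWeight α β 1),
    lintegral_dirichletWeight hα hβ one_pos, Real.one_rpow, mul_one, ← ENNReal.ofReal_mul hc.le,
    mul_inv_cancel₀ hc.ne', ENNReal.ofReal_one]

lemma integrableOn_dirichletDensity (hα : ∀ i, 0 < α i) (hβ : 0 < β) :
    IntegrableOn (dirichletDensity α β) (simplex d) := by
  refine ⟨by fun_prop, ?_⟩
  rw [hasFiniteIntegral_iff_ofReal (ae_dirichletDensity_nonneg hα hβ),
    lintegral_dirichletDensity hα hβ]
  exact ENNReal.one_lt_top

lemma integral_dirichletDensity (hα : ∀ i, 0 < α i) (hβ : 0 < β) :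
    ∫ x in simplex d, dirichletDensity α β x = 1 := by
  rw [integral_eq_lintegral_of_nonneg_ae (ae_dirichletDensity_nonneg hα hβ) (by fun_prop),
    lintegral_dirichletDensity hα hβ, ENNReal.toReal_one]

lemma single_one_nonneg (i j : Fin d) : 0 ≤ (Pi.single i 1 : Fin d → ℝ) j := by
  rw [Pi.single_apply]
  split_ifs <;> norm_num

lemma add_single_one_pos (hα : ∀ i, 0 < α i) (i j : Fin d) :
    0 < (α + Pi.single i 1 : Fin d → ℝ) j :=
  add_pos_of_pos_of_nonneg (hα j) (single_one_nonneg i j)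

lemma l1Norm_add_single_one (hα : ∀ i, 0 ≤ α i) (i : Fin d) :
    l1Norm (α + Pi.single i 1) = l1Norm α + 1 := by
  have hnonneg : ∀ j, 0 ≤ (α + Pi.single i 1 : Fin d → ℝ) j := fun j =>
    add_nonneg (hα j) (single_one_nonneg i j)
  rw [l1Norm_of_nonneg hnonneg, l1Norm_of_nonneg hα]
  simp [Finset.sum_add_distrib]

lemma prod_add_single_one (F : Fin d → ℝ → ℝ) (α : Fin d → ℝ) (i : Fin d) {c : ℝ}
    (hc : F i (α i + 1) = c * F i (α i)) :
    ∏ j, F j ((α + Pi.single i 1 : Fin d → ℝ) j) = c * ∏ j, F j (α j) := by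
  rw [← Finset.mul_prod_erase _ _ (Finset.mem_univ i),
    ← Finset.mul_prod_erase _ (fun j => F j (α j)) (Finset.mem_univ i), Pi.add_apply,
    Pi.single_eq_same, hc, mul_assoc]
  congr 2
  exact Finset.prod_congr rfl fun j hj => by
    rw [Pi.add_apply, Pi.single_eq_of_ne (Finset.ne_of_mem_erase hj), add_zero]

lemma dirichletConst_add_single_one (hα : ∀ i, 0 < α i) (hβ : 0 < β) (i : Fin d) :
    dirichletConst α β = α i / (l1Norm α + β) * dirichletConst (α + Pi.single i 1) β := by
  have hpos : 0 < l1Norm α + β := by linarith [l1Norm_nonneg α]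
  have hΓβ := (Real.Gamma_pos_of_pos hβ).ne'
  have hΓα : ∏ i, Real.Gamma (α i) ≠ 0 :=
    Finset.prod_ne_zero_iff.2 fun i _ => (Real.Gamma_pos_of_pos (hα i)).ne'
  have hαi := (hα i).ne'
  rw [dirichletConst, dirichletConst, l1Norm_add_single_one fun j => (hα j).le, add_right_comm,
    Real.Gamma_add_one hpos.ne',
    prod_add_single_one (fun _ => Real.Gamma) α i (Real.Gamma_add_one hαi)]
  field_simp

lemma dirichletDensity_mul_coord (hα : ∀ i, 0 < α i) (hβ : 0 < β) (i : Fin d)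
    (hx : x ∈ simplex d) :
    dirichletDensity α β x * x i =
      α i / (l1Norm α + β) * dirichletDensity (α + Pi.single i 1) β x := by
  have hpow : ∏ j, x j ^ ((α + Pi.single i 1 : Fin d → ℝ) j - 1) =
      x i * ∏ j, x j ^ (α j - 1) := by
    refine prod_add_single_one (fun j a => x j ^ (a - 1)) α i ?_
    rw [mul_comm, ← Real.rpow_add_one' (nonneg_of_mem_simplex hx i) (by simpa using (hα i).ne'),
      add_sub_right_comm]
  rw [dirichletDensity_eq, dirichletDensity_eq, hpow, dirichletConst_add_single_one hα hβ i]
  ring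

end DirichletDensity

section Taylor

variable {E F : Type*} [NormedAddCommGroup E] [NormedSpace ℝ E] [NormedAddCommGroup F]
  [NormedSpace ℝ F] {f : E → F} {K : Set E} {s x : E}

/-- The remainder of the second-order Taylor expansion of `f` around `s`. -/
noncomputable def taylorRemainder (f : E → F) (s x : E) : F :=
  f x - f s - fderiv ℝ f s (x - s) - (1 / 2 : ℝ) • fderiv ℝ (fderiv ℝ f) s (x - s) (x - s)

lemma hasFDerivWithinAt_sub_taylor_two {D : E →L[ℝ] F} {A : E →L[ℝ] F} {B : E →L[ℝ] E →L[ℝ] F}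
    (hf : HasFDerivWithinAt f D K x) (hB : ∀ v w, B v w = B w v) :
    HasFDerivWithinAt (fun y => f y - A (y - s) - (1 / 2 : ℝ) • B (y - s) (y - s))
      (D - A - B (x - s)) K x := by
  have hid : HasFDerivAt (fun y => y - s) (ContinuousLinearMap.id ℝ E) x :=
    (hasFDerivAt_id x).sub_const s
  have hquad := ((B.hasFDerivAt.comp x hid).clm_apply hid).const_smul (1 / 2 : ℝ)
  refine ((hf.sub (A.hasFDerivAt.comp x hid).hasFDerivWithinAt).sub
    hquad.hasFDerivWithinAt).congr_fderiv ?_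
  ext w
  have hhalf : (1 / 2 : ℝ) • (B (x - s) w + B w (x - s)) = B (x - s) w := by
    rw [hB w, ← two_smul ℝ, smul_smul]
    norm_num
  simpa using hhalf

lemma norm_sub_taylor_two_le (hK : Convex ℝ K) {D : E → E →L[ℝ] F}
    {D₂ : E → E →L[ℝ] E →L[ℝ] F} (hD : ∀ y ∈ K, HasFDerivWithinAt f (D y) K y)
    (hD₂ : ∀ y ∈ K, HasFDerivWithinAt D (D₂ y) K y) (hs : s ∈ K) (hx : x ∈ K)
    (hsymm : ∀ v w, D₂ s v w = D₂ s w v) {c : ℝ}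
    (hc : ∀ y ∈ K, ‖y - s‖ ≤ ‖x - s‖ → ‖D₂ y - D₂ s‖ ≤ c) :
    ‖f x - f s - D s (x - s) - (1 / 2 : ℝ) • D₂ s (x - s) (x - s)‖ ≤ c * ‖x - s‖ ^ 2 := by
  set T := K ∩ Metric.closedBall s ‖x - s‖
  have hT : Convex ℝ T := hK.inter (convex_closedBall s _)
  have hTK : T ⊆ K := Set.inter_subset_left
  have hsT : s ∈ T := ⟨hs, Metric.mem_closedBall_self (norm_nonneg _)⟩
  have hxT : x ∈ T := ⟨hx, mem_closedBall_iff_norm.2 le_rfl⟩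
  have hc0 : 0 ≤ c := (norm_nonneg (D₂ x - D₂ s)).trans (hc x hx le_rfl)
  have hfirst : ∀ y ∈ T, ‖D y - D s - D₂ s (y - s)‖ ≤ c * ‖x - s‖ := fun y hy =>
    (hT.norm_image_sub_le_of_norm_hasFDerivWithin_le' (fun z hz => (hD₂ z hz.1).mono hTK)
      (fun z hz => hc z hz.1 (mem_closedBall_iff_norm.1 hz.2)) hsT hy).trans
      (mul_le_mul_of_nonneg_left (mem_closedBall_iff_norm.1 hy.2) hc0)
  have hsecond := hT.norm_image_sub_le_of_norm_hasFDerivWithin_le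
    (fun y hy => hasFDerivWithinAt_sub_taylor_two (s := s) ((hD y hy.1).mono hTK) hsymm)
    hfirst hsT hxT
  simp only [sub_self, map_zero, smul_zero, sub_zero] at hsecond
  calc _ = ‖f x - D s (x - s) - (1 / 2 : ℝ) • D₂ s (x - s) (x - s) - f s‖ := by
        congr 1
        abel
    _ ≤ c * ‖x - s‖ * ‖x - s‖ := hsecond
    _ = c * ‖x - s‖ ^ 2 := by ring

lemma fderivWithin_eventuallyEq_fderiv (hs : s ∈ interior K) :
    fderivWithin ℝ f K =ᶠ[𝓝 s] fderiv ℝ f := by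
  filter_upwards [isOpen_interior.mem_nhds hs] with y hy
  exact fderivWithin_of_mem_nhds (mem_interior_iff_mem_nhds.1 hy)

lemma fderivWithin_fderivWithin_of_mem_interior (hs : s ∈ interior K) :
    fderivWithin ℝ (fderivWithin ℝ f K) K s = fderiv ℝ (fderiv ℝ f) s := by
  rw [fderivWithin_of_mem_nhds (mem_interior_iff_mem_nhds.1 hs),
    (fderivWithin_eventuallyEq_fderiv hs).fderiv_eq]

lemma norm_taylorRemainder_le (hK : Convex ℝ K) (hf : ContDiffOn ℝ 2 f K) (hs : s ∈ interior K)
    (hx : x ∈ K) {c : ℝ}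
    (hc : ∀ y ∈ K, ‖y - s‖ ≤ ‖x - s‖ → ‖fderivWithin ℝ (fderivWithin ℝ f K) K y -
      fderivWithin ℝ (fderivWithin ℝ f K) K s‖ ≤ c) :
    ‖taylorRemainder f s x‖ ≤ c * ‖x - s‖ ^ 2 := by
  have hf' : ContDiffOn ℝ 1 (fderivWithin ℝ f K) K :=
    hf.fderivWithin (uniqueDiffOn_convex hK ⟨s, hs⟩) (by norm_num)
  have hsymm : IsSymmSndFDerivAt ℝ f s :=
    (hf.contDiffAt (mem_interior_iff_mem_nhds.1 hs)).isSymmSndFDerivAt (by simp)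
  have htaylor := norm_sub_taylor_two_le hK
    (fun y hy => (hf.differentiableOn (by norm_num) y hy).hasFDerivWithinAt)
    (fun y hy => (hf'.differentiableOn (by norm_num) y hy).hasFDerivWithinAt)
    (interior_subset hs) hx
    (fun v w => by rw [fderivWithin_fderivWithin_of_mem_interior hs, hsymm v w]) hc
  rwa [fderivWithin_fderivWithin_of_mem_interior hs,
    (fderivWithin_eventuallyEq_fderiv hs).self_of_nhds] at htaylor

lemma continuousOn_fderivWithin_fderivWithin (hK : UniqueDiffOn ℝ K) (hf : ContDiffOn ℝ 2 f K) :
    ContinuousOn (fderivWithin ℝ (fderivWithin ℝ f K) K) K :=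
  (hf.fderivWithin hK (m := 1) (by norm_num)).continuousOn_fderivWithin hK (by norm_num)

/-- Close to `s` the remainder is controlled by the uniform continuity of the second derivative, and
far from `s` by its boundedness, the fourth power absorbing the factor `δ⁻²`. -/
lemma exists_norm_taylorRemainder_le (hK : Convex ℝ K) (hKc : IsCompact K)
    (hf : ContDiffOn ℝ 2 f K) {ε : ℝ} (hε : 0 < ε) :
    ∃ C, 0 ≤ C ∧ ∀ s ∈ interior K, ∀ x ∈ K,
      ‖taylorRemainder f s x‖ ≤ ε * ‖x - s‖ ^ 2 + C * ‖x - s‖ ^ 4 := by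
  rcases (interior K).eq_empty_or_nonempty with hempty | hne
  · exact ⟨0, le_rfl, fun s hs => by simp [hempty] at hs⟩
  have hcont := continuousOn_fderivWithin_fderivWithin (uniqueDiffOn_convex hK hne) hf
  obtain ⟨M, hM⟩ := hKc.exists_bound_of_continuousOn (E := E →L[ℝ] E →L[ℝ] F) hcont
  obtain ⟨δ, hδ, hclose⟩ := (Metric.uniformContinuousOn_iff (β := E →L[ℝ] E →L[ℝ] F)).1
    (hKc.uniformContinuousOn_of_continuous hcont) ε hε
  have hM0 : 0 ≤ M := (norm_nonneg _).trans (hM _ (interior_subset hne.some_mem))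
  refine ⟨(M + M) / δ ^ 2, by positivity, fun s hs x hx => ?_⟩
  have hsK := interior_subset hs
  rcases lt_or_ge ‖x - s‖ δ with hnear | hfar
  · have hosc := norm_taylorRemainder_le hK hf hs hx (c := ε) fun y hy hys =>
      (dist_eq_norm (E := E →L[ℝ] E →L[ℝ] F) _ _).symm.trans_le
        (hclose y hy s hsK (by rw [dist_eq_norm]; linarith)).le
    exact hosc.trans (le_add_of_nonneg_right (by positivity))
  · have hbound := norm_taylorRemainder_le hK hf hs hx (c := M + M) fun y hy _ =>
      (norm_sub_le _ _).trans (add_le_add (hM y hy) (hM s hsK))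
    refine hbound.trans (le_add_of_nonneg_of_le (by positivity) ?_)
    calc (M + M) * ‖x - s‖ ^ 2 = (M + M) / δ ^ 2 * (δ ^ 2 * ‖x - s‖ ^ 2) := by field_simp
      _ ≤ (M + M) / δ ^ 2 * (‖x - s‖ ^ 2 * ‖x - s‖ ^ 2) := by gcongr
      _ = (M + M) / δ ^ 2 * ‖x - s‖ ^ 4 := by ring

lemma exists_norm_fderiv_le (hK : UniqueDiffOn ℝ K) (hKc : IsCompact K)
    (hf : ContDiffOn ℝ 2 f K) :
    ∃ M, 0 ≤ M ∧ ∀ s ∈ interior K, ‖fderiv ℝ f s‖ ≤ M ∧ ‖fderiv ℝ (fderiv ℝ f) s‖ ≤ M := by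
  obtain ⟨M₁, hM₁⟩ := hKc.exists_bound_of_continuousOn
    (hf.continuousOn_fderivWithin hK (by norm_num))
  obtain ⟨M₂, hM₂⟩ := hKc.exists_bound_of_continuousOn (E := E →L[ℝ] E →L[ℝ] F)
    (continuousOn_fderivWithin_fderivWithin hK hf)
  refine ⟨max 0 (max M₁ M₂), le_max_left _ _, fun s hs => ⟨?_, ?_⟩⟩
  · rw [← (fderivWithin_eventuallyEq_fderiv hs).self_of_nhds]
    exact (hM₁ s (interior_subset hs)).trans (by simp)
  · rw [← fderivWithin_fderivWithin_of_mem_interior hs]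
    exact (hM₂ s (interior_subset hs)).trans (by simp)

end Taylor

section PartialDerivatives

variable {d : ℕ} {f : (Fin d → ℝ) → ℝ} {s : Fin d → ℝ}

lemma simplexInt_subset_interior (d : ℕ) : simplexInt d ⊆ interior (simplex d) :=
  interior_maximal (simplexInt_subset_simplex d) (isOpen_simplexInt d)

lemma uniqueDiffOn_simplex (d : ℕ) : UniqueDiffOn ℝ (simplex d) :=
  uniqueDiffOn_convex (convex_simplex d)
    ((simplexInt_nonempty d).mono (simplexInt_subset_interior d))

lemma clm_apply_eq_sum_single {F : Type*} [NormedAddCommGroup F] [NormedSpace ℝ F]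
    (L : (Fin d → ℝ) →L[ℝ] F) (v : Fin d → ℝ) : L v = ∑ i, v i • L (Pi.single i 1) := by
  conv_lhs => rw [pi_eq_sum_univ' v, map_sum]
  simp only [map_smul]

lemma partialDeriv_partialDeriv (hf : ContDiffAt ℝ 2 f s) (i j : Fin d) :
    partialDeriv i (partialDeriv j f) s =
      fderiv ℝ (fderiv ℝ f) s (Pi.single i 1) (Pi.single j 1) := by
  have hdiff : DifferentiableAt ℝ (fderiv ℝ f) s :=
    (hf.fderiv_right (m := 1) (by norm_num)).differentiableAt (by norm_num)
  unfold partialDeriv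
  rw [fderiv_clm_apply hdiff (by fun_prop)]
  simp

lemma exists_abs_partialDeriv_le (hf : ContDiffOn ℝ 2 f (simplex d)) :
    ∃ M, 0 ≤ M ∧ ∀ s ∈ simplexInt d, (∀ i, |partialDeriv i f s| ≤ M) ∧
      ∀ i j, |partialDeriv i (partialDeriv j f) s| ≤ M := by
  obtain ⟨M, hM0, hM⟩ := exists_norm_fderiv_le (uniqueDiffOn_simplex d) (isCompact_simplex d) hf
  have hsingle : ∀ i : Fin d, ‖(Pi.single i 1 : Fin d → ℝ)‖ = 1 := fun i => by
    rw [Pi.norm_single, norm_one]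
  refine ⟨M, hM0, fun s hs => ⟨fun i => ?_, fun i j => ?_⟩⟩
  · have hle := (fderiv ℝ f s).le_opNorm (Pi.single i 1)
    rw [hsingle, mul_one] at hle
    exact hle.trans (hM s (simplexInt_subset_interior d hs)).1
  · have hle := (fderiv ℝ (fderiv ℝ f) s).le_opNorm₂ (Pi.single i 1) (Pi.single j 1)
    rw [hsingle, hsingle, mul_one, mul_one] at hle
    rw [partialDeriv_partialDeriv (hf.contDiffAt (simplex_mem_nhds hs))]
    exact hle.trans (hM s (simplexInt_subset_interior d hs)).2

/-- The second-order differential operator with drift `a` and diffusion matrix `A`, applied to `f`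
at `s`. Both the second-order Taylor polynomial and `gTerm` are of this form. -/
noncomputable def secondOrderOperator (a : Fin d → ℝ) (A : Fin d → Fin d → ℝ)
    (f : (Fin d → ℝ) → ℝ) (s : Fin d → ℝ) : ℝ :=
  ∑ i, a i * partialDeriv i f s +
    (1 / 2) * ∑ i, ∑ j, A i j * partialDeriv i (partialDeriv j f) s

lemma secondOrderOperator_sub_mul (a a' : Fin d → ℝ) (A A' : Fin d → Fin d → ℝ) (c : ℝ) :
    secondOrderOperator (fun i => a i - c * a' i) (fun i j => A i j - c * A' i j) f s =
      secondOrderOperator a A f s - c * secondOrderOperator a' A' f s := by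
  simp only [secondOrderOperator, sub_mul, Finset.sum_sub_distrib, mul_assoc, ← Finset.mul_sum]
  ring

lemma abs_secondOrderOperator_le {a : Fin d → ℝ} {A : Fin d → Fin d → ℝ} {c M : ℝ}
    (ha : ∀ i, |a i| ≤ c) (hA : ∀ i j, |A i j| ≤ c) (hc : 0 ≤ c)
    (hM : ∀ i, |partialDeriv i f s| ≤ M)
    (hM₂ : ∀ i j, |partialDeriv i (partialDeriv j f) s| ≤ M) :
    |secondOrderOperator a A f s| ≤ (d + d ^ 2) * (c * M) := by
  have hdrift : |∑ i, a i * partialDeriv i f s| ≤ d * (c * M) :=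
    calc _ ≤ ∑ i, |a i * partialDeriv i f s| := Finset.abs_sum_le_sum_abs _ _
      _ ≤ ∑ _ : Fin d, c * M := Finset.sum_le_sum fun i _ =>
          (abs_mul _ _).trans_le (mul_le_mul (ha i) (hM i) (abs_nonneg _) hc)
      _ = d * (c * M) := by simp
  have hdiffusion : |∑ i, ∑ j, A i j * partialDeriv i (partialDeriv j f) s| ≤ d ^ 2 * (c * M) :=
    calc _ ≤ ∑ i, ∑ j, |A i j * partialDeriv i (partialDeriv j f) s| :=
          (Finset.abs_sum_le_sum_abs _ _).trans
            (Finset.sum_le_sum fun i _ => Finset.abs_sum_le_sum_abs _ _)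
      _ ≤ ∑ _ : Fin d, ∑ _ : Fin d, c * M := Finset.sum_le_sum fun i _ =>
          Finset.sum_le_sum fun j _ =>
            (abs_mul _ _).trans_le (mul_le_mul (hA i j) (hM₂ i j) (abs_nonneg _) hc)
      _ = d ^ 2 * (c * M) := by simp [pow_two, mul_assoc]
  calc |secondOrderOperator a A f s|
      ≤ |∑ i, a i * partialDeriv i f s| +
          |(1 / 2) * ∑ i, ∑ j, A i j * partialDeriv i (partialDeriv j f) s| := abs_add_le _ _
    _ ≤ d * (c * M) + d ^ 2 * (c * M) := by
        rw [abs_mul, abs_of_pos (one_half_pos (α := ℝ))]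
        linarith [abs_nonneg (∑ i, ∑ j, A i j * partialDeriv i (partialDeriv j f) s)]
    _ = (d + d ^ 2) * (c * M) := by ring

lemma eq_secondOrderOperator_add_taylorRemainder (hf : ContDiffAt ℝ 2 f s) (x : Fin d → ℝ) :
    f x = f s + secondOrderOperator (fun i => x i - s i)
      (fun i j => (x i - s i) * (x j - s j)) f s + taylorRemainder f s x := by
  have hlin : fderiv ℝ f s (x - s) = ∑ i, (x i - s i) * partialDeriv i f s :=
    clm_apply_eq_sum_single _ _
  have hquad : fderiv ℝ (fderiv ℝ f) s (x - s) (x - s) =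
      ∑ i, ∑ j, (x i - s i) * (x j - s j) * partialDeriv i (partialDeriv j f) s := by
    rw [clm_apply_eq_sum_single (fderiv ℝ (fderiv ℝ f) s), _root_.sum_apply]
    refine Finset.sum_congr rfl fun i _ => ?_
    rw [_root_.smul_apply, clm_apply_eq_sum_single, Finset.smul_sum]
    refine Finset.sum_congr rfl fun j _ => ?_
    rw [partialDeriv_partialDeriv hf, Pi.sub_apply, Pi.sub_apply, smul_eq_mul, smul_eq_mul,
      mul_assoc]
  rw [taylorRemainder, secondOrderOperator, hlin, hquad, smul_eq_mul]
  ring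

lemma continuousOn_taylorRemainder {K : Set (Fin d → ℝ)} (hf : ContinuousOn f K) :
    ContinuousOn (taylorRemainder f s) K := by
  unfold taylorRemainder
  fun_prop

end PartialDerivatives

section DirichletMean

variable {d : ℕ} {α : Fin d → ℝ} {β : ℝ} {g h : (Fin d → ℝ) → ℝ}

/-- The expectation of `h` under the Dirichlet distribution with parameters `(α, β)`. -/
noncomputable def dirichletMean (α : Fin d → ℝ) (β : ℝ) (h : (Fin d → ℝ) → ℝ) : ℝ :=
  ∫ x in simplex d, dirichletDensity α β x * h x

lemma integrableOn_dirichletDensity_mul (hα : ∀ i, 0 < α i) (hβ : 0 < β)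
    (hh : ContinuousOn h (simplex d)) :
    IntegrableOn (fun x => dirichletDensity α β x * h x) (simplex d) :=
  (integrableOn_dirichletDensity hα hβ).mul_continuousOn hh (isCompact_simplex d)

lemma dirichletMean_add (hα : ∀ i, 0 < α i) (hβ : 0 < β) (hg : ContinuousOn g (simplex d))
    (hh : ContinuousOn h (simplex d)) :
    dirichletMean α β (fun x => g x + h x) = dirichletMean α β g + dirichletMean α β h := by
  simp only [dirichletMean, mul_add]
  exact integral_add (integrableOn_dirichletDensity_mul hα hβ hg)
    (integrableOn_dirichletDensity_mul hα hβ hh)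

lemma dirichletMean_const_mul (α : Fin d → ℝ) (β c : ℝ) (h : (Fin d → ℝ) → ℝ) :
    dirichletMean α β (fun x => c * h x) = c * dirichletMean α β h := by
  simp only [dirichletMean, mul_left_comm, integral_const_mul]

lemma dirichletMean_sub (hα : ∀ i, 0 < α i) (hβ : 0 < β) (hg : ContinuousOn g (simplex d))
    (hh : ContinuousOn h (simplex d)) :
    dirichletMean α β (fun x => g x - h x) = dirichletMean α β g - dirichletMean α β h := by
  simp only [dirichletMean, mul_sub]
  exact integral_sub (integrableOn_dirichletDensity_mul hα hβ hg)
    (integrableOn_dirichletDensity_mul hα hβ hh)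

lemma dirichletMean_const (hα : ∀ i, 0 < α i) (hβ : 0 < β) (c : ℝ) :
    dirichletMean α β (fun _ => c) = c := by
  rw [dirichletMean, integral_mul_const, integral_dirichletDensity hα hβ, one_mul]

lemma dirichletMean_sum {ι : Type*} (t : Finset ι) {G : ι → (Fin d → ℝ) → ℝ} (hα : ∀ i, 0 < α i)
    (hβ : 0 < β) (hG : ∀ k, ContinuousOn (G k) (simplex d)) :
    dirichletMean α β (fun x => ∑ k ∈ t, G k x) = ∑ k ∈ t, dirichletMean α β (G k) := by
  simp only [dirichletMean, Finset.mul_sum]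
  exact integral_finsetSum _ fun k _ => integrableOn_dirichletDensity_mul hα hβ (hG k)

lemma dirichletMean_mono (hα : ∀ i, 0 < α i) (hβ : 0 < β) (hg : ContinuousOn g (simplex d))
    (hh : ContinuousOn h (simplex d)) (hgh : ∀ x ∈ simplex d, g x ≤ h x) :
    dirichletMean α β g ≤ dirichletMean α β h :=
  setIntegral_mono_on (integrableOn_dirichletDensity_mul hα hβ hg)
    (integrableOn_dirichletDensity_mul hα hβ hh) (measurableSet_simplex d) fun x hx =>
      mul_le_mul_of_nonneg_left (hgh x hx) (dirichletDensity_nonneg hα hβ hx)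

lemma abs_dirichletMean_le (hα : ∀ i, 0 < α i) (hβ : 0 < β)
    (hh : ContinuousOn h (simplex d)) (hgh : ∀ x ∈ simplex d, |g x| ≤ h x) :
    |dirichletMean α β g| ≤ dirichletMean α β h := by
  rw [← Real.norm_eq_abs]
  refine norm_integral_le_of_norm_le (integrableOn_dirichletDensity_mul hα hβ hh) ?_
  refine (ae_restrict_iff' (measurableSet_simplex d)).2 (ae_of_all _ fun x hx => ?_)
  rw [norm_mul, Real.norm_of_nonneg (dirichletDensity_nonneg hα hβ hx), Real.norm_eq_abs]
  exact mul_le_mul_of_nonneg_left (hgh x hx) (dirichletDensity_nonneg hα hβ hx)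

lemma dirichletMean_coord_mul (hα : ∀ i, 0 < α i) (hβ : 0 < β) (i : Fin d)
    (h : (Fin d → ℝ) → ℝ) :
    dirichletMean α β (fun x => x i * h x) =
      α i / (l1Norm α + β) * dirichletMean (α + Pi.single i 1) β h := by
  simp only [dirichletMean, ← integral_const_mul]
  refine setIntegral_congr_fun (measurableSet_simplex d) fun x hx => ?_
  rw [← mul_assoc, dirichletDensity_mul_coord hα hβ i hx, mul_assoc]

lemma dirichletMean_coord_pow (hα : ∀ i, 0 < α i) (hβ : 0 < β) (i : Fin d) (k : ℕ) :
    dirichletMean α β (fun x => x i ^ k) =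
      ∏ j ∈ Finset.range k, (α i + j) / (l1Norm α + β + j) := by
  induction k generalizing α with
  | zero => simp [dirichletMean_const hα hβ]
  | succ k ih =>
    simp only [pow_succ']
    rw [dirichletMean_coord_mul hα hβ, ih (add_single_one_pos hα i), Finset.prod_range_succ',
      mul_comm]
    simp only [l1Norm_add_single_one fun j => (hα j).le, Pi.add_apply, Pi.single_eq_same,
      Nat.cast_add, Nat.cast_one, Nat.cast_zero, add_zero]
    congr 1
    exact Finset.prod_congr rfl fun j _ => by congr 1 <;> ring

lemma dirichletMean_coord (hα : ∀ i, 0 < α i) (hβ : 0 < β) (i : Fin d) :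
    dirichletMean α β (fun x => x i) = α i / (l1Norm α + β) := by
  simpa using dirichletMean_coord_pow hα hβ i 1

lemma dirichletMean_coord_mul_coord (hα : ∀ i, 0 < α i) (hβ : 0 < β) (i j : Fin d) :
    dirichletMean α β (fun x => x i * x j) =
      α i / (l1Norm α + β) * ((α j + if i = j then 1 else 0) / (l1Norm α + β + 1)) := by
  rw [dirichletMean_coord_mul hα hβ, dirichletMean_coord (add_single_one_pos hα i) hβ,
    l1Norm_add_single_one fun j => (hα j).le, Pi.add_apply, Pi.single_apply, add_right_comm]
  simp only [eq_comm (a := j)]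

lemma dirichletMean_sub_mul_sub (hα : ∀ i, 0 < α i) (hβ : 0 < β) (i j : Fin d) (c c' : ℝ) :
    dirichletMean α β (fun x => (x i - c) * (x j - c')) =
      α i / (l1Norm α + β) * ((if i = j then 1 else 0) - α j / (l1Norm α + β)) /
        (l1Norm α + β + 1) + (α i / (l1Norm α + β) - c) * (α j / (l1Norm α + β) - c') := by
  have hA : 0 < l1Norm α + β := by linarith [l1Norm_nonneg α]
  have hexpand : (fun x : Fin d → ℝ => (x i - c) * (x j - c')) =
      fun x => x i * x j - c' * x i - c * (x j - c') := by
    ext x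
    ring
  rw [hexpand, dirichletMean_sub hα hβ (by fun_prop) (by fun_prop),
    dirichletMean_sub hα hβ (by fun_prop) (by fun_prop), dirichletMean_const_mul,
    dirichletMean_const_mul, dirichletMean_sub hα hβ (by fun_prop) (by fun_prop),
    dirichletMean_const hα hβ, dirichletMean_coord_mul_coord hα hβ, dirichletMean_coord hα hβ,
    dirichletMean_coord hα hβ]
  field_simp
  ring

/-- Integration by parts for the marginals, which are beta distributions. -/
lemma dirichletMean_coord_sub_mul_eval (hα : ∀ i, 0 < α i) (hβ : 0 < β) (i : Fin d)
    (p : Polynomial ℝ) :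
    (l1Norm α + β) * dirichletMean α β (fun x => (x i - α i / (l1Norm α + β)) * p.eval (x i)) =
      dirichletMean α β (fun x => x i * (1 - x i) * p.derivative.eval (x i)) := by
  have hA : 0 < l1Norm α + β := by linarith [l1Norm_nonneg α]
  induction p using Polynomial.induction_on' with
  | add p q hp hq =>
    simp only [Polynomial.eval_add, Polynomial.derivative_add, mul_add]
    rw [dirichletMean_add hα hβ (by fun_prop) (by fun_prop), mul_add, hp, hq,
      dirichletMean_add hα hβ (by fun_prop) (by fun_prop)]
  | monomial k c =>
    have hrec : (l1Norm α + β + k) * dirichletMean α β (fun x => x i ^ (k + 1)) =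
        (α i + k) * dirichletMean α β (fun x => x i ^ k) := by
      rw [dirichletMean_coord_pow hα hβ, dirichletMean_coord_pow hα hβ, Finset.prod_range_succ]
      field_simp
    have hleft : (fun x : Fin d → ℝ => (x i - α i / (l1Norm α + β)) *
        (Polynomial.monomial k c).eval (x i)) =
        fun x => c * (x i ^ (k + 1) - α i / (l1Norm α + β) * x i ^ k) := by
      ext x
      rw [Polynomial.eval_monomial]
      ring
    have hright : (fun x : Fin d → ℝ => x i * (1 - x i) *
        (Polynomial.monomial k c).derivative.eval (x i)) =
        fun x => c * k * (x i ^ k - x i ^ (k + 1)) := by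
      ext x
      rw [Polynomial.derivative_monomial, Polynomial.eval_monomial]
      cases k with
      | zero => simp
      | succ k => simp only [Nat.add_sub_cancel]; ring
    rw [hleft, hright, dirichletMean_const_mul, dirichletMean_const_mul,
      dirichletMean_sub hα hβ (by fun_prop) (by fun_prop), dirichletMean_const_mul,
      dirichletMean_sub hα hβ (by fun_prop) (by fun_prop)]
    field_simp
    linear_combination c * hrec

lemma coord_mul_one_sub_le (t : ℝ) : t * (1 - t) ≤ 1 / 4 := by
  nlinarith [sq_nonneg (t - 1 / 2)]

lemma dirichletMean_coord_sub_sq_le (hα : ∀ i, 0 < α i) (hβ : 0 < β) (i : Fin d) :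
    (l1Norm α + β) * dirichletMean α β (fun x => (x i - α i / (l1Norm α + β)) ^ 2) ≤ 1 / 4 := by
  have hparts := dirichletMean_coord_sub_mul_eval hα hβ i
    (Polynomial.X - Polynomial.C (α i / (l1Norm α + β)))
  simp only [Polynomial.eval_sub, Polynomial.eval_X, Polynomial.eval_C, Polynomial.derivative_sub,
    Polynomial.derivative_X, Polynomial.derivative_C, sub_zero, Polynomial.eval_one, mul_one,
    ← pow_two] at hparts
  rw [hparts, ← dirichletMean_const hα hβ (1 / 4)]
  exact dirichletMean_mono hα hβ (by fun_prop) (by fun_prop) fun x _ => coord_mul_one_sub_le _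

lemma dirichletMean_coord_sub_pow_four_le (hα : ∀ i, 0 < α i) (hβ : 0 < β) (i : Fin d) :
    (l1Norm α + β) ^ 2 * dirichletMean α β (fun x => (x i - α i / (l1Norm α + β)) ^ 4) ≤
      3 / 16 := by
  have hA : 0 < l1Norm α + β := by linarith [l1Norm_nonneg α]
  set m := α i / (l1Norm α + β) with hm
  have hparts := dirichletMean_coord_sub_mul_eval hα hβ i
    ((Polynomial.X - Polynomial.C m) ^ 3)
  simp only [Polynomial.eval_pow, Polynomial.eval_sub, Polynomial.eval_X, Polynomial.eval_C,
    Polynomial.derivative_X_sub_C_pow, Polynomial.eval_mul, ← hm, ← pow_succ'] at hparts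
  have hle : dirichletMean α β (fun x => x i * (1 - x i) * ((3 : ℕ) * (x i - m) ^ 2)) ≤
      3 / 4 * dirichletMean α β (fun x => (x i - m) ^ 2) := by
    rw [← dirichletMean_const_mul]
    refine dirichletMean_mono hα hβ (by fun_prop) (by fun_prop) fun x _ => ?_
    push_cast
    nlinarith [mul_le_mul_of_nonneg_right (coord_mul_one_sub_le (x i)) (sq_nonneg (x i - m))]
  calc (l1Norm α + β) ^ 2 * dirichletMean α β (fun x => (x i - m) ^ 4)
      = (l1Norm α + β) * ((l1Norm α + β) * dirichletMean α β (fun x => (x i - m) ^ 4)) := by ring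
    _ ≤ (l1Norm α + β) * (3 / 4 * dirichletMean α β (fun x => (x i - m) ^ 2)) :=
        mul_le_mul_of_nonneg_left (hparts.trans_le hle) hA.le
    _ ≤ 3 / 16 := by linarith [dirichletMean_coord_sub_sq_le hα hβ i]

end DirichletMean

section KernelMean

variable {d : ℕ} {f : (Fin d → ℝ) → ℝ} {s : Fin d → ℝ} {b : ℝ}

lemma kernel_alpha_pos (hs : s ∈ simplex d) (hb : 0 < b) (i : Fin d) : 0 < s i / b + 1 := by
  linarith [div_nonneg (nonneg_of_mem_simplex hs i) hb.le]

lemma kernel_beta_pos (hs : s ∈ simplex d) (hb : 0 < b) : 0 < (1 - l1Norm s) / b + 1 := by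
  linarith [div_nonneg (sub_nonneg.2 hs.2) hb.le]

lemma l1Norm_kernel_alpha_add_beta (hs : s ∈ simplex d) (hb : 0 < b) :
    l1Norm (fun i => s i / b + 1) + ((1 - l1Norm s) / b + 1) = 1 / b + (d + 1) := by
  rw [l1Norm_of_nonneg fun i => (kernel_alpha_pos hs hb i).le,
    l1Norm_of_nonneg (nonneg_of_mem_simplex hs), Finset.sum_add_distrib, ← Finset.sum_div,
    Fin.sum_const, nsmul_eq_mul, mul_one]
  ring

/-- The expectation of `h` under the Dirichlet kernel with bandwidth `b` at `s`. -/
noncomputable def kernelMean (b : ℝ) (s : Fin d → ℝ) (h : (Fin d → ℝ) → ℝ) : ℝ :=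
  dirichletMean (fun i => s i / b + 1) ((1 - l1Norm s) / b + 1) h

lemma kernelMean_eq (b : ℝ) (s : Fin d → ℝ) (h : (Fin d → ℝ) → ℝ) :
    kernelMean b s h = ∫ x in simplex d, kernel b s x * h x := rfl

/-- The centre of mass of the Dirichlet kernel with bandwidth `b` at `s`. -/
noncomputable def kernelCenter (b : ℝ) (s : Fin d → ℝ) : Fin d → ℝ :=
  fun i => (s i + b) / (1 + (d + 1) * b)

lemma kernel_alpha_div_eq_kernelCenter (hs : s ∈ simplex d) (hb : 0 < b) (i : Fin d) :
    (s i / b + 1) / (l1Norm (fun i => s i / b + 1) + ((1 - l1Norm s) / b + 1)) =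
      kernelCenter b s i := by
  rw [l1Norm_kernel_alpha_add_beta hs hb, kernelCenter]
  field_simp

lemma kernelCenter_sub (hb : 0 < b) (i : Fin d) :
    kernelCenter b s i - s i = b * (1 - (d + 1) * s i) / (1 + (d + 1) * b) := by
  rw [kernelCenter]
  field_simp
  ring

lemma kernelCenter_mem_Icc (hs : s ∈ simplex d) (hb : 0 < b) (i : Fin d) :
    kernelCenter b s i ∈ Set.Icc (0 : ℝ) 1 := by
  obtain ⟨h0, h1⟩ := hs.1 i
  refine ⟨by unfold kernelCenter; positivity, div_le_one_of_le₀ ?_ (by positivity)⟩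
  linarith [mul_nonneg (Nat.cast_nonneg (α := ℝ) d) hb.le]

lemma abs_drift_le (hs : s ∈ simplex d) (i : Fin d) : |1 - ((d : ℝ) + 1) * s i| ≤ d + 1 := by
  obtain ⟨h0, h1⟩ := hs.1 i
  have hd : (0 : ℝ) ≤ d := Nat.cast_nonneg d
  rw [abs_le]
  constructor <;> nlinarith [mul_nonneg hd h0, mul_nonneg hd (sub_nonneg.2 h1)]

lemma abs_kernelCenter_sub_le (hs : s ∈ simplex d) (hb : 0 < b) (i : Fin d) :
    |kernelCenter b s i - s i| ≤ (d + 1) * b := by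
  have hden : 1 ≤ 1 + ((d : ℝ) + 1) * b := by linarith [mul_pos (Nat.cast_add_one_pos d) hb]
  rw [kernelCenter_sub hb, abs_div, abs_mul, abs_of_pos hb,
    abs_of_pos (by linarith : 0 < 1 + ((d : ℝ) + 1) * b), mul_comm b]
  calc |1 - ((d : ℝ) + 1) * s i| * b / (1 + (d + 1) * b)
      ≤ |1 - ((d : ℝ) + 1) * s i| * b := div_le_self (by positivity) hden
    _ ≤ (d + 1) * b := by gcongr; exact abs_drift_le hs i

lemma kernelMean_sub_coord (hs : s ∈ simplex d) (hb : 0 < b) (i : Fin d) :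
    kernelMean b s (fun x => x i - s i) = kernelCenter b s i - s i := by
  have hα := kernel_alpha_pos hs hb
  have hβ := kernel_beta_pos hs hb
  rw [kernelMean, dirichletMean_sub hα hβ (by fun_prop) (by fun_prop), dirichletMean_const hα hβ,
    dirichletMean_coord hα hβ, kernel_alpha_div_eq_kernelCenter hs hb]

lemma abs_kernelMean_sub_coord_sub_le (hs : s ∈ simplex d) (hb : 0 < b) (i : Fin d) :
    |kernelMean b s (fun x => x i - s i) - b * (1 - (d + 1) * s i)| ≤ (d + 1) ^ 2 * b ^ 2 := by
  have hsplit : kernelCenter b s i - s i - b * (1 - (d + 1) * s i) =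
      -((d + 1) * b * (kernelCenter b s i - s i)) := by
    rw [kernelCenter_sub hb]
    field_simp
    ring
  rw [kernelMean_sub_coord hs hb, hsplit, abs_neg, abs_mul, abs_of_nonneg (by positivity)]
  calc (d + 1) * b * |kernelCenter b s i - s i| ≤ (d + 1) * b * ((d + 1) * b) := by
        gcongr
        exact abs_kernelCenter_sub_le hs hb i
    _ = (d + 1) ^ 2 * b ^ 2 := by ring

lemma kernelMean_sub_mul_sub (hs : s ∈ simplex d) (hb : 0 < b) (i j : Fin d) :
    kernelMean b s (fun x => (x i - s i) * (x j - s j)) =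
      b / (1 + (d + 2) * b) *
        (kernelCenter b s i * ((if i = j then 1 else 0) - kernelCenter b s j)) +
        (kernelCenter b s i - s i) * (kernelCenter b s j - s j) := by
  rw [kernelMean, dirichletMean_sub_mul_sub (kernel_alpha_pos hs hb) (kernel_beta_pos hs hb),
    kernel_alpha_div_eq_kernelCenter hs hb, kernel_alpha_div_eq_kernelCenter hs hb,
    l1Norm_kernel_alpha_add_beta hs hb]
  congr 1
  field_simp
  ring

lemma abs_mul_ite_sub_le_one {u v : ℝ} (hu : u ∈ Set.Icc (0 : ℝ) 1) (hv : v ∈ Set.Icc (0 : ℝ) 1)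
    (p : Prop) [Decidable p] : |u * ((if p then 1 else 0) - v)| ≤ 1 := by
  rw [abs_mul, abs_of_nonneg hu.1]
  refine mul_le_one₀ hu.2 (abs_nonneg _) (abs_le.2 ?_)
  split_ifs <;> constructor <;> linarith [hv.1, hv.2]

lemma abs_kernelCenter_mul_sub_le (hs : s ∈ simplex d) (hb : 0 < b) (i j : Fin d) (p : Prop)
    [Decidable p] :
    |kernelCenter b s i * ((if p then 1 else 0) - kernelCenter b s j) -
      s i * ((if p then 1 else 0) - s j)| ≤ 2 * (d + 1) * b := by
  obtain ⟨hj0, hj1⟩ := kernelCenter_mem_Icc hs hb j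
  set e : ℝ := if p then 1 else 0
  have he : |e - kernelCenter b s j| ≤ 1 := by
    rw [abs_le]
    simp only [e]
    split_ifs <;> constructor <;> linarith
  have hs1 : |s i| ≤ 1 := (abs_of_nonneg (hs.1 i).1).trans_le (hs.1 i).2
  calc |kernelCenter b s i * (e - kernelCenter b s j) - s i * (e - s j)|
      = |(kernelCenter b s i - s i) * (e - kernelCenter b s j) -
          s i * (kernelCenter b s j - s j)| := by ring_nf
    _ ≤ |kernelCenter b s i - s i| * |e - kernelCenter b s j| +
          |s i| * |kernelCenter b s j - s j| := by
        rw [← abs_mul, ← abs_mul]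
        exact abs_sub _ _
    _ ≤ (d + 1) * b * 1 + 1 * ((d + 1) * b) := by
        gcongr
        · exact abs_kernelCenter_sub_le hs hb i
        · exact abs_kernelCenter_sub_le hs hb j
    _ = 2 * (d + 1) * b := by ring

lemma abs_div_one_add_mul_sub_le {b c : ℝ} (hb : 0 ≤ b) (hc : 0 ≤ c) :
    |b / (1 + c * b) - b| ≤ c * b ^ 2 := by
  have hdiff : b / (1 + c * b) - b = -(c * b ^ 2 / (1 + c * b)) := by
    field_simp
    ring
  rw [hdiff, abs_neg, abs_of_nonneg (by positivity)]
  exact div_le_self (by positivity) (le_add_of_nonneg_right (by positivity))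

lemma abs_kernelMean_sub_mul_sub_sub_le (hs : s ∈ simplex d) (hb : 0 < b) (i j : Fin d) :
    |kernelMean b s (fun x => (x i - s i) * (x j - s j)) -
      b * (s i * ((if i = j then 1 else 0) - s j))| ≤ ((d : ℝ) + 3) ^ 2 * b ^ 2 := by
  have hcov := abs_mul_ite_sub_le_one (kernelCenter_mem_Icc hs hb i)
    (kernelCenter_mem_Icc hs hb j) (i = j)
  have hcov_sub := abs_kernelCenter_mul_sub_le hs hb i j (i = j)
  rw [kernelMean_sub_mul_sub hs hb]
  set V := kernelCenter b s i * ((if i = j then 1 else 0) - kernelCenter b s j)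
  set V₀ := s i * ((if i = j then 1 else 0) - s j)
  calc |b / (1 + (d + 2) * b) * V + (kernelCenter b s i - s i) * (kernelCenter b s j - s j) -
          b * V₀|
      = |(b / (1 + (d + 2) * b) - b) * V + b * (V - V₀) +
          (kernelCenter b s i - s i) * (kernelCenter b s j - s j)| := by ring_nf
    _ ≤ |b / (1 + (d + 2) * b) - b| * |V| + b * |V - V₀| +
          |kernelCenter b s i - s i| * |kernelCenter b s j - s j| := by
        rw [← abs_mul, ← abs_mul, ← abs_of_pos hb, ← abs_mul, abs_of_pos hb]
        exact abs_add_three _ _ _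
    _ ≤ (d + 2) * b ^ 2 * 1 + b * (2 * (d + 1) * b) + (d + 1) * b * ((d + 1) * b) := by
        gcongr
        · exact abs_div_one_add_mul_sub_le hb.le (by positivity)
        · exact abs_kernelCenter_sub_le hs hb i
        · exact abs_kernelCenter_sub_le hs hb j
    _ ≤ (d + 3) ^ 2 * b ^ 2 := by nlinarith [mul_nonneg (Nat.cast_nonneg (α := ℝ) d) (sq_nonneg b)]

lemma kernelMean_sub_sq_le (hs : s ∈ simplex d) (hb : 0 < b) (i : Fin d) :
    kernelMean b s (fun x => (x i - s i) ^ 2) ≤ b + ((d : ℝ) + 3) ^ 2 * b ^ 2 := by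
  have happrox := (abs_le.1 (abs_kernelMean_sub_mul_sub_sub_le hs hb i i)).2
  have hvar : b * (s i * ((if i = i then 1 else 0) - s i)) ≤ b * 1 := by
    gcongr
    exact (le_abs_self _).trans (abs_mul_ite_sub_le_one (hs.1 i) (hs.1 i) _)
  simp only [pow_two (_ - _)]
  linarith

lemma kernelMean_sub_kernelCenter_pow_four_le (hs : s ∈ simplex d) (hb : 0 < b) (i : Fin d) :
    kernelMean b s (fun x => (x i - kernelCenter b s i) ^ 4) ≤ b ^ 2 := by
  have hfourth := dirichletMean_coord_sub_pow_four_le (kernel_alpha_pos hs hb)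
    (kernel_beta_pos hs hb) i
  rw [kernel_alpha_div_eq_kernelCenter hs hb, l1Norm_kernel_alpha_add_beta hs hb] at hfourth
  have hscale : b⁻¹ ^ 2 ≤ (1 / b + ((d : ℝ) + 1)) ^ 2 := by
    rw [← one_div]
    gcongr
    exact le_add_of_nonneg_right (by positivity)
  have hnonneg : 0 ≤ kernelMean b s (fun x => (x i - kernelCenter b s i) ^ 4) := by
    rw [← dirichletMean_const (kernel_alpha_pos hs hb) (kernel_beta_pos hs hb) 0]
    exact dirichletMean_mono (kernel_alpha_pos hs hb) (kernel_beta_pos hs hb) (by fun_prop)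
      (by fun_prop) fun x _ => by positivity
  have hle := (mul_le_mul_of_nonneg_right hscale hnonneg).trans hfourth
  rw [inv_pow, inv_mul_le_iff₀ (by positivity)] at hle
  nlinarith [sq_nonneg b]

lemma kernelMean_sub_pow_four_le (hs : s ∈ simplex d) (hb : 0 < b) (i : Fin d) :
    kernelMean b s (fun x => (x i - s i) ^ 4) ≤ 8 * (1 + (d + 1) ^ 2) * b ^ 2 := by
  have hα := kernel_alpha_pos hs hb
  have hβ := kernel_beta_pos hs hb
  set m := kernelCenter b s i
  have hm : (m - s i) ^ 4 ≤ (d + 1) ^ 2 * b ^ 2 := by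
    obtain ⟨h0, h1⟩ := kernelCenter_mem_Icc hs hb i
    have hone : (m - s i) ^ 2 ≤ 1 := by nlinarith [hs.1 i |>.1, hs.1 i |>.2]
    have hsq : (m - s i) ^ 2 ≤ ((d + 1) * b) ^ 2 :=
      sq_le_sq' (abs_le.1 (abs_kernelCenter_sub_le hs hb i)).1
        (abs_le.1 (abs_kernelCenter_sub_le hs hb i)).2
    nlinarith [sq_nonneg (m - s i)]
  have hmean := kernelMean_sub_kernelCenter_pow_four_le hs hb i
  unfold kernelMean at hmean ⊢
  calc _ ≤ dirichletMean (fun i => s i / b + 1) ((1 - l1Norm s) / b + 1)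
          (fun x => 8 * ((x i - m) ^ 4 + (m - s i) ^ 4)) := by
        refine dirichletMean_mono hα hβ (by fun_prop) (by fun_prop) fun x _ => ?_
        have hpow := (show Even 4 by decide).add_pow_le (a := x i - m) (b := m - s i)
        norm_num at hpow
        exact hpow
    _ ≤ 8 * (b ^ 2 + (d + 1) ^ 2 * b ^ 2) := by
        rw [dirichletMean_const_mul, dirichletMean_add hα hβ (by fun_prop) (by fun_prop),
          dirichletMean_const hα hβ]
        gcongr
    _ = 8 * (1 + (d + 1) ^ 2) * b ^ 2 := by ring

end KernelMean

section Bias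

variable {d : ℕ} {f : (Fin d → ℝ) → ℝ} {s : Fin d → ℝ} {b : ℝ}

lemma dirichletMean_secondOrderOperator {α : Fin d → ℝ} {β : ℝ} (hα : ∀ i, 0 < α i) (hβ : 0 < β)
    {a : Fin d → (Fin d → ℝ) → ℝ} {A : Fin d → Fin d → (Fin d → ℝ) → ℝ}
    (ha : ∀ i, ContinuousOn (a i) (simplex d)) (hA : ∀ i j, ContinuousOn (A i j) (simplex d))
    (f : (Fin d → ℝ) → ℝ) (s : Fin d → ℝ) :
    dirichletMean α β
        (fun x => secondOrderOperator (fun i => a i x) (fun i j => A i j x) f s) =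
      secondOrderOperator (fun i => dirichletMean α β (a i))
        (fun i j => dirichletMean α β (A i j)) f s := by
  simp only [secondOrderOperator, mul_comm _ (partialDeriv _ _ _)]
  rw [dirichletMean_add hα hβ (by fun_prop) (by fun_prop), dirichletMean_const_mul,
    dirichletMean_sum _ hα hβ fun i => by fun_prop, dirichletMean_sum _ hα hβ fun i => by fun_prop]
  simp only [dirichletMean_const_mul]
  congr! 3 with i
  rw [dirichletMean_sum _ hα hβ fun j => by fun_prop]
  simp only [dirichletMean_const_mul]

lemma kernelMean_eq_secondOrderOperator_add (hf : ContDiffOn ℝ 2 f (simplex d))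
    (hs : s ∈ simplexInt d) (hb : 0 < b) :
    kernelMean b s f = f s + secondOrderOperator (fun i => kernelMean b s fun x => x i - s i)
      (fun i j => kernelMean b s fun x => (x i - s i) * (x j - s j)) f s +
        kernelMean b s (taylorRemainder f s) := by
  have hα := kernel_alpha_pos (simplexInt_subset_simplex d hs) hb
  have hβ := kernel_beta_pos (simplexInt_subset_simplex d hs) hb
  have hop : Continuous fun x : Fin d → ℝ => secondOrderOperator (fun i => x i - s i)
      (fun i j => (x i - s i) * (x j - s j)) f s := by
    unfold secondOrderOperator
    fun_prop
  unfold kernelMean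
  calc dirichletMean _ _ f
      = dirichletMean _ _ fun x => f s + secondOrderOperator (fun i => x i - s i)
          (fun i j => (x i - s i) * (x j - s j)) f s + taylorRemainder f s x :=
        congrArg _ <| funext <|
          eq_secondOrderOperator_add_taylorRemainder (hf.contDiffAt (simplex_mem_nhds hs))
    _ = _ := by
        rw [dirichletMean_add hα hβ (continuousOn_const.fun_add hop.continuousOn)
            (continuousOn_taylorRemainder hf.continuousOn),
          dirichletMean_add hα hβ continuousOn_const hop.continuousOn, dirichletMean_const hα hβ,
          dirichletMean_secondOrderOperator hα hβ (fun i => by fun_prop) fun i j => by fun_prop]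

lemma norm_pow_le_sum_pow {ι : Type*} [Fintype ι] (v : ι → ℝ) {k : ℕ} (hk : Even k)
    (hk0 : k ≠ 0) : ‖v‖ ^ k ≤ ∑ i, v i ^ k := by
  rcases isEmpty_or_nonempty ι with hempty | hne
  · simp [Subsingleton.elim v 0, hk0]
  · obtain ⟨i, hi⟩ := Finite.exists_max fun i => |v i|
    calc ‖v‖ ^ k ≤ |v i| ^ k := by
          gcongr
          exact (pi_norm_le_iff_of_nonneg (abs_nonneg _)).2 hi
      _ = v i ^ k := hk.pow_abs _
      _ ≤ ∑ i, v i ^ k := Finset.single_le_sum (fun j _ => hk.pow_nonneg _) (Finset.mem_univ i)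

lemma exists_abs_kernelMean_taylorRemainder_le (hf : ContDiffOn ℝ 2 f (simplex d)) {ε : ℝ}
    (hε : 0 < ε) :
    ∃ C, ∀ s ∈ simplexInt d, ∀ b, 0 < b →
      |kernelMean b s (taylorRemainder f s)| ≤ ε * b + C * b ^ 2 := by
  set η : ℝ := ε / (d + 1) with hη
  have hη0 : 0 < η := by positivity
  have hηε : η * d ≤ ε := by
    rw [hη, div_mul_eq_mul_div, div_le_iff₀ (by positivity)]
    nlinarith
  obtain ⟨C, hC0, hC⟩ :=
    exists_norm_taylorRemainder_le (convex_simplex d) (isCompact_simplex d) hf hη0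
  refine ⟨η * d * (d + 3) ^ 2 + C * (d * (8 * (1 + (d + 1) ^ 2))), fun s hs b hb => ?_⟩
  have hsS := simplexInt_subset_simplex d hs
  have hα := kernel_alpha_pos hsS hb
  have hβ := kernel_beta_pos hsS hb
  have hpointwise : ∀ x ∈ simplex d, |taylorRemainder f s x| ≤
      η * ∑ i, (x i - s i) ^ 2 + C * ∑ i, (x i - s i) ^ 4 := fun x hx =>
    (hC s (simplexInt_subset_interior d hs) x hx).trans <| add_le_add
      (mul_le_mul_of_nonneg_left (norm_pow_le_sum_pow (x - s) (by decide) (by decide)) hη0.le)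
      (mul_le_mul_of_nonneg_left (norm_pow_le_sum_pow (x - s) (by decide) (by decide)) hC0)
  calc |kernelMean b s (taylorRemainder f s)|
      ≤ kernelMean b s (fun x => η * ∑ i, (x i - s i) ^ 2 + C * ∑ i, (x i - s i) ^ 4) :=
        abs_dirichletMean_le hα hβ (by fun_prop) hpointwise
    _ = η * ∑ i, kernelMean b s (fun x => (x i - s i) ^ 2) +
          C * ∑ i, kernelMean b s (fun x => (x i - s i) ^ 4) := by
        unfold kernelMean
        rw [dirichletMean_add hα hβ (by fun_prop) (by fun_prop), dirichletMean_const_mul,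
          dirichletMean_const_mul, dirichletMean_sum _ hα hβ fun i => by fun_prop,
          dirichletMean_sum _ hα hβ fun i => by fun_prop]
    _ ≤ η * ∑ _ : Fin d, (b + ((d : ℝ) + 3) ^ 2 * b ^ 2) +
          C * ∑ _ : Fin d, 8 * (1 + ((d : ℝ) + 1) ^ 2) * b ^ 2 := by
        gcongr with i _ i _
        · exact kernelMean_sub_sq_le hsS hb i
        · exact kernelMean_sub_pow_four_le hsS hb i
    _ = η * d * b +
          (η * d * (d + 3) ^ 2 + C * (d * (8 * (1 + (d + 1) ^ 2)))) * b ^ 2 := by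
        simp only [Fin.sum_const, nsmul_eq_mul]
        ring
    _ ≤ _ := by gcongr

lemma exists_abs_kernelMean_sub_sub_le (hf : ContDiffOn ℝ 2 f (simplex d)) {ε : ℝ} (hε : 0 < ε) :
    ∃ C, ∀ s ∈ simplexInt d, ∀ b, 0 < b →
      |kernelMean b s f - f s - b * gTerm f s| ≤ ε * b + C * b ^ 2 := by
  obtain ⟨M, -, hM⟩ := exists_abs_partialDeriv_le hf
  obtain ⟨C, hC⟩ := exists_abs_kernelMean_taylorRemainder_le hf hε
  refine ⟨(d + d ^ 2) * ((d + 3) ^ 2 * M) + C, fun s hs b hb => ?_⟩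
  have hsS := simplexInt_subset_simplex d hs
  obtain ⟨hM₁, hM₂⟩ := hM s hs
  have hsplit : kernelMean b s f - f s - b * gTerm f s =
      secondOrderOperator
        (fun i => kernelMean b s (fun x => x i - s i) - b * (1 - (d + 1) * s i))
        (fun i j => kernelMean b s (fun x => (x i - s i) * (x j - s j)) -
          b * (s i * ((if i = j then 1 else 0) - s j))) f s +
        kernelMean b s (taylorRemainder f s) := by
    rw [secondOrderOperator_sub_mul, kernelMean_eq_secondOrderOperator_add hf hs hb,
      show secondOrderOperator _ _ f s = gTerm f s from rfl]
    ring
  have hdrift : ∀ i, |kernelMean b s (fun x => x i - s i) - b * (1 - (d + 1) * s i)| ≤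
      (d + 3) ^ 2 * b ^ 2 := fun i =>
    (abs_kernelMean_sub_coord_sub_le hsS hb i).trans (by gcongr; norm_num)
  have hop := abs_secondOrderOperator_le hdrift
    (fun i j => abs_kernelMean_sub_mul_sub_sub_le hsS hb i j) (by positivity) hM₁ hM₂
  rw [hsplit]
  calc _ ≤ (d + d ^ 2) * ((d + 3) ^ 2 * b ^ 2 * M) + (ε * b + C * b ^ 2) :=
        (abs_add_le _ _).trans (add_le_add hop (hC s hs b hb))
    _ = _ := by ring

lemma eventually_abs_kernelMean_sub_sub_le (hf : ContDiffOn ℝ 2 f (simplex d)) {ε : ℝ}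
    (hε : 0 < ε) :
    ∀ᶠ b in 𝓝[>] (0 : ℝ), ∀ s ∈ simplexInt d,
      |kernelMean b s f - f s - b * gTerm f s| ≤ ε * b := by
  obtain ⟨C, hC⟩ := exists_abs_kernelMean_sub_sub_le hf (half_pos hε)
  have hsmall : ∀ᶠ b in 𝓝[>] (0 : ℝ), C * b < ε / 2 := by
    have hlim : Tendsto (fun b : ℝ => C * b) (𝓝[>] 0) (𝓝 (C * 0)) :=
      (tendsto_id.const_mul C).mono_left nhdsWithin_le_nhds
    exact hlim.eventually_lt_const (by simpa using half_pos hε)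
  filter_upwards [hsmall, self_mem_nhdsWithin] with b hCb (hb : 0 < b) s hs
  exact (hC s hs b hb).trans (by nlinarith)

lemma exists_abs_gTerm_le (hf : ContDiffOn ℝ 2 f (simplex d)) :
    ∃ G, 0 ≤ G ∧ ∀ s ∈ simplexInt d, |gTerm f s| ≤ G := by
  obtain ⟨M, hM0, hM⟩ := exists_abs_partialDeriv_le hf
  refine ⟨(d + d ^ 2) * ((d + 1) * M), by positivity, fun s hs => ?_⟩
  have hsS := simplexInt_subset_simplex d hs
  exact abs_secondOrderOperator_le (abs_drift_le hsS)
    (fun i j => (abs_mul_ite_sub_le_one (hsS.1 i) (hsS.1 j) _).trans (by simp)) (by positivity)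
    (hM s hs).1 (hM s hs).2

end Bias

section Wallis

/-- The ratio `√x Γ(x + 1/2) / Γ(x + 1)`, which tends to one at infinity. It measures the relative
error in `(2x choose x) ≈ 4 ^ x / √(π x)`. -/
noncomputable def wallisRatio (x : ℝ) : ℝ := √x * Real.Gamma (x + 1 / 2) / Real.Gamma (x + 1)

lemma wallisRatio_pos {x : ℝ} (hx : 0 < x) : 0 < wallisRatio x :=
  div_pos (mul_pos (Real.sqrt_pos.2 hx) (Real.Gamma_pos_of_pos (by linarith)))
    (Real.Gamma_pos_of_pos (by linarith))

lemma Gamma_add_half_sq_le {x : ℝ} (hx : 0 < x) :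
    Real.Gamma (x + 1 / 2) ^ 2 ≤ Real.Gamma x * Real.Gamma (x + 1) := by
  have hΓ := (Real.Gamma_pos_of_pos hx).le
  have hconvex := Real.Gamma_mul_add_mul_le_rpow_Gamma_mul_rpow_Gamma hx (add_pos hx one_pos)
    one_half_pos one_half_pos (add_halves (1 : ℝ))
  rw [show 1 / 2 * x + 1 / 2 * (x + 1) = x + 1 / 2 by ring, ← Real.sqrt_eq_rpow,
    ← Real.sqrt_eq_rpow, ← Real.sqrt_mul hΓ] at hconvex
  exact (Real.le_sqrt' (Real.Gamma_pos_of_pos (by linarith))).1 hconvex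

lemma wallisRatio_sq {x : ℝ} (hx : 0 ≤ x) :
    wallisRatio x ^ 2 = x * Real.Gamma (x + 1 / 2) ^ 2 / Real.Gamma (x + 1) ^ 2 := by
  rw [wallisRatio, div_pow, mul_pow, Real.sq_sqrt hx]

lemma wallisRatio_le_one {x : ℝ} (hx : 0 < x) : wallisRatio x ≤ 1 := by
  refine (sq_le_one_iff₀ (wallisRatio_pos hx).le).1 ?_
  rw [wallisRatio_sq hx.le, div_le_one (by positivity)]
  calc x * Real.Gamma (x + 1 / 2) ^ 2 ≤ x * (Real.Gamma x * Real.Gamma (x + 1)) := by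
        gcongr
        exact Gamma_add_half_sq_le hx
    _ = Real.Gamma (x + 1) ^ 2 := by rw [Real.Gamma_add_one hx.ne']; ring

lemma le_wallisRatio_sq_mul {x : ℝ} (hx : 0 < x) : x ≤ wallisRatio x ^ 2 * (x + 1 / 2) := by
  have hlog := Gamma_add_half_sq_le (by linarith : 0 < x + 1 / 2)
  rw [show x + 1 / 2 + 1 / 2 = x + 1 by ring,
    Real.Gamma_add_one (by linarith : x + 1 / 2 ≠ 0)] at hlog
  rw [wallisRatio_sq hx.le, div_mul_eq_mul_div, le_div_iff₀ (by positivity)]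
  calc x * Real.Gamma (x + 1) ^ 2
      ≤ x * (Real.Gamma (x + 1 / 2) * ((x + 1 / 2) * Real.Gamma (x + 1 / 2))) := by gcongr
    _ = x * Real.Gamma (x + 1 / 2) ^ 2 * (x + 1 / 2) := by ring

lemma abs_wallisRatio_sub_one_le {x : ℝ} (hx : 0 < x) : |wallisRatio x - 1| ≤ 1 / x := by
  have hle := wallisRatio_le_one hx
  have hge := le_wallisRatio_sq_mul hx
  rw [abs_sub_comm, abs_of_nonneg (sub_nonneg.2 hle), le_div_iff₀ hx]
  nlinarith [wallisRatio_pos hx]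

/-- The central binomial coefficient `(2x choose x)` at a real argument. -/
noncomputable def gammaCentralBinom (x : ℝ) : ℝ := Real.Gamma (2 * x + 1) / Real.Gamma (x + 1) ^ 2

lemma gammaCentralBinom_eq {x : ℝ} (hx : 0 < x) :
    gammaCentralBinom x = 4 ^ x * wallisRatio x / √(Real.pi * x) := by
  have hdup := Real.Gamma_mul_Gamma_add_half (x + 1 / 2)
  rw [show x + 1 / 2 + 1 / 2 = x + 1 by ring, show 2 * (x + 1 / 2) = 2 * x + 1 by ring,
    show 1 - (2 * x + 1) = -(2 * x) by ring, Real.rpow_neg zero_le_two,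
    Real.rpow_mul zero_le_two, show (2 : ℝ) ^ (2 : ℝ) = 4 by norm_num] at hdup
  rw [gammaCentralBinom, wallisRatio, Real.sqrt_mul Real.pi_pos.le]
  calc Real.Gamma (2 * x + 1) / Real.Gamma (x + 1) ^ 2
      = 4 ^ x * (Real.Gamma (2 * x + 1) * (4 ^ x)⁻¹ * √Real.pi) /
          (√Real.pi * Real.Gamma (x + 1) ^ 2) := by field_simp
    _ = _ := by rw [← hdup]; field_simp

lemma Gamma_add_natCast_add_one {x : ℝ} (hx : 0 ≤ x) (d : ℕ) :
    Real.Gamma (x + (d + 1)) = (∏ j ∈ Finset.range d, (x + (j + 1))) * Real.Gamma (x + 1) := by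
  induction d with
  | zero => simp
  | succ d ih =>
    rw [Finset.prod_range_succ, mul_right_comm, ← ih, ← add_assoc,
      Real.Gamma_add_one (by positivity)]
    push_cast
    ring

end Wallis

section NearOne

variable {ι : Type*} {l : Filter ι} {F G φ : ι → ℝ}

lemma isBigO_mul_sub_one (hφ : φ =O[l] fun _ => (1 : ℝ)) (hF : (fun b => F b - 1) =O[l] φ)
    (hG : (fun b => G b - 1) =O[l] φ) : (fun b => F b * G b - 1) =O[l] φ := by
  have hF1 : F =O[l] fun _ => (1 : ℝ) := by
    simpa using (hF.trans hφ).add (isBigO_refl (fun _ : ι => (1 : ℝ)) l)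
  have hprod : (fun b => F b * (G b - 1)) =O[l] φ := by simpa using hF1.mul hG
  exact (hprod.add hF).congr_left fun b => by ring

lemma isBigO_prod_sub_one {κ : Type*} (t : Finset κ) {F : κ → ι → ℝ}
    (hφ : φ =O[l] fun _ => (1 : ℝ)) (hF : ∀ k ∈ t, (fun b => F k b - 1) =O[l] φ) :
    (fun b => ∏ k ∈ t, F k b - 1) =O[l] φ := by
  classical
  induction t using Finset.induction_on with
  | empty => simpa using isBigO_zero φ l
  | insert k t hk ih =>
    simp only [Finset.prod_insert hk]
    exact isBigO_mul_sub_one hφ (hF k (Finset.mem_insert_self k t))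
      (ih fun j hj => hF j (Finset.mem_insert_of_mem hj))

lemma isBigO_inv_sub_one (hφ : Tendsto φ l (𝓝 0)) (hF : (fun b => F b - 1) =O[l] φ) :
    (fun b => (F b)⁻¹ - 1) =O[l] φ := by
  have hlim : Tendsto F l (𝓝 1) := by simpa using (hF.trans_tendsto hφ).add_const 1
  have hinv := (hlim.inv₀ one_ne_zero).isBigO_one ℝ
  refine (hinv.mul hF.neg_left).congr' ?_ (Eventually.of_forall fun b => one_mul _)
  filter_upwards [hlim.eventually_ne one_ne_zero] with b hb
  field_simp
  ring

lemma isBigO_one_add_mul_sub_one (c : ℝ) (φ : ι → ℝ) (l : Filter ι) :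
    (fun b => (1 + c * φ b) - 1) =O[l] φ := by
  simpa using isBigO_const_mul_self c φ l

lemma isBigO_wallisRatio_div_sub_one {c : ℝ} (hc : 0 < c) :
    (fun b => wallisRatio (c / b) - 1) =O[𝓝[>] 0] fun b : ℝ => b := by
  refine IsBigO.of_bound (1 / c) ?_
  filter_upwards [self_mem_nhdsWithin] with b (hb : 0 < b)
  rw [Real.norm_eq_abs, Real.norm_of_nonneg hb.le]
  refine (abs_wallisRatio_sub_one_le (div_pos hc hb)).trans_eq ?_
  field_simp

end NearOne

section KernelSquare

variable {d : ℕ} {f : (Fin d → ℝ) → ℝ} {s x : Fin d → ℝ} {b : ℝ}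

lemma dirichletDensity_sq {α : Fin d → ℝ} {β : ℝ} (hα : ∀ i, 1 / 2 < α i) (hβ : 1 / 2 < β)
    (hx : x ∈ simplex d) :
    dirichletDensity α β x ^ 2 =
      dirichletConst α β ^ 2 / dirichletConst (fun i => 2 * α i - 1) (2 * β - 1) *
        dirichletDensity (fun i => 2 * α i - 1) (2 * β - 1) x := by
  have hsq : ∀ y a : ℝ, 0 ≤ y → (y ^ (a - 1)) ^ 2 = y ^ (2 * a - 1 - 1) := fun y a hy => by
    rw [← Real.rpow_natCast, ← Real.rpow_mul hy]
    congr 1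
    push_cast
    ring
  have hconst := (dirichletConst_pos (fun i => by linarith [hα i] : ∀ i, 0 < 2 * α i - 1)
    (by linarith : 0 < 2 * β - 1)).ne'
  rw [dirichletDensity_eq, dirichletDensity_eq, mul_pow, mul_pow, ← Finset.prod_pow,
    hsq _ _ (sub_nonneg.2 hx.2),
    Finset.prod_congr rfl fun i _ => hsq _ _ (nonneg_of_mem_simplex hx i)]
  field_simp

lemma dirichletConst_add_one {a : Fin d → ℝ} {w : ℝ} (ha : ∀ i, 0 ≤ a i) (hw : 0 ≤ w) :
    dirichletConst (fun i => a i + 1) (w + 1) =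
      (∏ j ∈ Finset.range d, (∑ i, a i + w + (j + 1))) * Real.Gamma (∑ i, a i + w + 1) /
        (Real.Gamma (w + 1) * ∏ i, Real.Gamma (a i + 1)) := by
  have htotal : l1Norm (fun i => a i + 1) + (w + 1) = ∑ i, a i + w + (d + 1) := by
    rw [l1Norm_of_nonneg fun i => add_nonneg (ha i) zero_le_one, Finset.sum_add_distrib,
      Fin.sum_const, nsmul_eq_mul]
    ring
  rw [dirichletConst, htotal,
    Gamma_add_natCast_add_one (add_nonneg (Finset.sum_nonneg fun i _ => ha i) hw)]

lemma dirichletConst_add_one_sq_div {a : Fin d → ℝ} {w N : ℝ} (ha : ∀ i, 0 ≤ a i) (hw : 0 ≤ w)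
    (hN : ∑ i, a i + w = N) :
    dirichletConst (fun i => a i + 1) (w + 1) ^ 2 /
        dirichletConst (fun i => 2 * a i + 1) (2 * w + 1) =
      (∏ j ∈ Finset.range d, (N + (j + 1)) ^ 2 / (2 * N + (j + 1))) *
        (gammaCentralBinom w * (∏ i, gammaCentralBinom (a i)) / gammaCentralBinom N) := by
  have hN0 : 0 ≤ N := hN ▸ add_nonneg (Finset.sum_nonneg fun i _ => ha i) hw
  have hΓ : ∀ t : ℝ, 0 ≤ t → Real.Gamma (t + 1) ≠ 0 := fun t ht =>
    (Real.Gamma_pos_of_pos (by positivity)).ne'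
  have hΓa := Finset.prod_ne_zero_iff.2 fun i (_ : i ∈ Finset.univ) => hΓ (a i) (ha i)
  have hΓ2a := Finset.prod_ne_zero_iff.2 fun i (_ : i ∈ Finset.univ) =>
    hΓ (2 * a i) (mul_nonneg zero_le_two (ha i))
  rw [dirichletConst_add_one ha hw, dirichletConst_add_one
    (fun i => mul_nonneg zero_le_two (ha i)) (mul_nonneg zero_le_two hw), ← Finset.mul_sum,
    ← mul_add, hN]
  simp only [gammaCentralBinom, Finset.prod_div_distrib, Finset.prod_pow]
  field_simp

/-- The relative error in the asymptotics of the `L²` norm of the Dirichlet kernel. -/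
noncomputable def kernelSqError (s : Fin d → ℝ) (b : ℝ) : ℝ :=
  (∏ j ∈ Finset.range d, (1 + (j + 1) * b) * (1 + (j + 1) * b) * (1 + (j + 1) / 2 * b)⁻¹) *
    (wallisRatio ((1 - l1Norm s) / b) * (∏ i, wallisRatio (s i / b)) * (wallisRatio (1 / b))⁻¹)

lemma isBigO_kernelSqError_sub_one (hs : s ∈ simplexInt d) :
    (fun b => kernelSqError s b - 1) =O[𝓝[>] 0] fun b : ℝ => b := by
  have hlim : Tendsto (fun b : ℝ => b) (𝓝[>] 0) (𝓝 0) := tendsto_nhdsWithin_of_tendsto_nhds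
    tendsto_id
  have hone := hlim.isBigO_one ℝ
  have hlin : ∀ c : ℝ, (fun b : ℝ => (1 + c * b) - 1) =O[𝓝[>] 0] fun b : ℝ => b := fun c =>
    isBigO_one_add_mul_sub_one c _ _
  refine isBigO_mul_sub_one hone (isBigO_prod_sub_one _ hone fun j _ => ?_) ?_
  · exact isBigO_mul_sub_one hone (isBigO_mul_sub_one hone (hlin _) (hlin _))
      (isBigO_inv_sub_one hlim (hlin _))
  · exact isBigO_mul_sub_one hone (isBigO_mul_sub_one hone
      (isBigO_wallisRatio_div_sub_one (one_sub_l1Norm_pos hs))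
      (isBigO_prod_sub_one _ hone fun i _ => isBigO_wallisRatio_div_sub_one (hs.1 i).1))
      (isBigO_inv_sub_one hlim (isBigO_wallisRatio_div_sub_one one_pos))

lemma prod_simplexInt_pos (hs : s ∈ simplexInt d) : 0 < ∏ i, s i :=
  Finset.prod_pos fun i _ => (hs.1 i).1

lemma psi_eq (hs : s ∈ simplexInt d) :
    psi s = ((2 * √Real.pi) ^ d * √(1 - l1Norm s) * ∏ i, √(s i))⁻¹ := by
  have hw := one_sub_l1Norm_pos hs
  have hpi : √((4 * Real.pi) ^ d) = (2 * √Real.pi) ^ d := by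
    rw [← Real.sqrt_sq (by positivity : 0 ≤ (2 * √Real.pi) ^ d), ← pow_mul, mul_comm d, pow_mul,
      mul_pow 2, Real.sq_sqrt Real.pi_pos.le]
    norm_num
  rw [psi, Real.rpow_neg (mul_pos (by positivity) (prod_simplexInt_pos hs)).le,
    ← Real.sqrt_eq_rpow, Real.sqrt_mul (by positivity), Real.sqrt_mul (by positivity), hpi,
    Real.sqrt_prod _ fun i _ => (hs.1 i).1.le]

lemma psi_pos (hs : s ∈ simplexInt d) : 0 < psi s :=
  Real.rpow_pos_of_pos (mul_pos (mul_pos (pow_pos (mul_pos four_pos Real.pi_pos) d)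
    (one_sub_l1Norm_pos hs)) (prod_simplexInt_pos hs)) _

lemma prod_sq_div_eq (d : ℕ) (hb : 0 < b) :
    ∏ j ∈ Finset.range d, (1 / b + ((j : ℝ) + 1)) ^ 2 / (2 * (1 / b) + (j + 1)) =
      (1 / b / 2) ^ d * ∏ j ∈ Finset.range d,
        (1 + ((j : ℝ) + 1) * b) * (1 + (j + 1) * b) * (1 + (j + 1) / 2 * b)⁻¹ := by
  rw [← Finset.card_range d, ← Finset.prod_const, Finset.card_range, ← Finset.prod_mul_distrib]
  refine Finset.prod_congr rfl fun j _ => ?_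
  field_simp

lemma gammaCentralBinom_mul_prod_div (hs : s ∈ simplexInt d) (hb : 0 < b) :
    gammaCentralBinom ((1 - l1Norm s) / b) * (∏ i, gammaCentralBinom (s i / b)) /
        gammaCentralBinom (1 / b) =
      wallisRatio ((1 - l1Norm s) / b) * (∏ i, wallisRatio (s i / b)) * (wallisRatio (1 / b))⁻¹ /
        (√(Real.pi / b) ^ d * √(1 - l1Norm s) * ∏ i, √(s i)) := by
  have hw := one_sub_l1Norm_pos hs
  have hfour : (4 : ℝ) ^ ((1 - l1Norm s) / b) * ∏ i, (4 : ℝ) ^ (s i / b) = 4 ^ (1 / b) := by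
    rw [← Real.rpow_sum_of_pos four_pos, ← Real.rpow_add four_pos, ← Finset.sum_div, ← add_div,
      l1Norm_of_nonneg fun i => (hs.1 i).1.le, sub_add_cancel]
  have hsqrt : ∀ t : ℝ, √(Real.pi * (t / b)) = √(Real.pi / b) * √t := fun t => by
    rw [← Real.sqrt_mul (by positivity)]
    congr 1
    ring
  have hroots : ∏ i, √(s i) ≠ 0 :=
    Finset.prod_ne_zero_iff.2 fun i _ => (Real.sqrt_pos.2 (hs.1 i).1).ne'
  have hratio := (wallisRatio_pos (one_div_pos.2 hb)).ne'
  have hpows : ∏ i, (4 : ℝ) ^ (s i / b) ≠ 0 := Finset.prod_ne_zero_iff.2 fun i _ => by positivity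
  rw [gammaCentralBinom_eq (div_pos hw hb), gammaCentralBinom_eq (one_div_pos.2 hb),
    Finset.prod_congr rfl fun i _ => gammaCentralBinom_eq (div_pos (hs.1 i).1 hb), ← hfour]
  simp only [hsqrt, Finset.prod_div_distrib, Finset.prod_mul_distrib, Fin.prod_const,
    Real.sqrt_one]
  field_simp

lemma half_div_pow_div_sqrt_pow (d : ℕ) (hb : 0 < b) :
    (1 / b / 2) ^ d / √(Real.pi / b) ^ d = b ^ (-(d : ℝ) / 2) * ((2 * √Real.pi) ^ d)⁻¹ := by
  have hpow : b ^ (-(d : ℝ) / 2) = (√b)⁻¹ ^ d := by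
    rw [neg_div, Real.rpow_neg hb.le, inv_pow, Real.sqrt_eq_rpow, ← Real.rpow_natCast,
      ← Real.rpow_mul hb.le]
    congr 2
    ring
  rw [hpow, ← div_pow, ← inv_pow, ← mul_pow, Real.sqrt_div Real.pi_pos.le]
  congr 1
  field_simp
  rw [Real.sq_sqrt hb.le]

lemma dirichletConst_kernel_sq_div (hs : s ∈ simplexInt d) (hb : 0 < b) :
    dirichletConst (fun i => s i / b + 1) ((1 - l1Norm s) / b + 1) ^ 2 /
        dirichletConst (fun i => 2 * (s i / b) + 1) (2 * ((1 - l1Norm s) / b) + 1) =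
      b ^ (-(d : ℝ) / 2) * psi s * kernelSqError s b := by
  have hsum : ∑ i, s i / b + (1 - l1Norm s) / b = 1 / b := by
    rw [← Finset.sum_div, ← add_div, l1Norm_of_nonneg fun i => (hs.1 i).1.le, add_sub_cancel]
  rw [dirichletConst_add_one_sq_div (fun i => (div_pos (hs.1 i).1 hb).le)
      (div_pos (one_sub_l1Norm_pos hs) hb).le hsum,
    gammaCentralBinom_mul_prod_div hs hb, prod_sq_div_eq d hb, psi_eq hs, kernelSqError]
  linear_combination (∏ j ∈ Finset.range d,
    (1 + ((j : ℝ) + 1) * b) * (1 + (j + 1) * b) * (1 + (j + 1) / 2 * b)⁻¹) *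
    (wallisRatio ((1 - l1Norm s) / b) * (∏ i, wallisRatio (s i / b)) * (wallisRatio (1 / b))⁻¹) *
    (√(1 - l1Norm s) * ∏ i, √(s i))⁻¹ * half_div_pow_div_sqrt_pow d hb

lemma kernel_sq (hs : s ∈ simplexInt d) (hb : 0 < b) (hx : x ∈ simplex d) :
    kernel b s x ^ 2 = b ^ (-(d : ℝ) / 2) * psi s * kernelSqError s b * kernel (b / 2) s x := by
  have hdouble : ∀ t : ℝ, 2 * (t / b + 1) - 1 = 2 * (t / b) + 1 := fun t => by ring
  have hhalf : ∀ t : ℝ, t / (b / 2) = 2 * (t / b) := fun t => by field_simp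
  rw [kernel, dirichletDensity_sq (fun i => by linarith [div_pos (hs.1 i).1 hb])
    (by linarith [div_pos (one_sub_l1Norm_pos hs) hb]) hx]
  simp only [kernel, hdouble, hhalf, dirichletConst_kernel_sq_div hs hb]

lemma integral_kernel_sq_mul (hs : s ∈ simplexInt d) (hb : 0 < b) (f : (Fin d → ℝ) → ℝ) :
    ∫ x in simplex d, kernel b s x ^ 2 * f x =
      b ^ (-(d : ℝ) / 2) * psi s * kernelSqError s b * kernelMean (b / 2) s f := by
  rw [kernelMean_eq, ← integral_const_mul]
  refine setIntegral_congr_fun (measurableSet_simplex d) fun x hx => ?_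
  simp only [kernel_sq hs hb hx, mul_assoc]

lemma isBigO_kernelMean_sub (hf : ContDiffOn ℝ 2 f (simplex d)) (hs : s ∈ simplexInt d) :
    (fun b => kernelMean b s f - f s) =O[𝓝[>] 0] fun b : ℝ => b := by
  have hbias : (fun b => kernelMean b s f - f s - b * gTerm f s) =O[𝓝[>] 0] fun b : ℝ => b := by
    refine IsBigO.of_bound 1 ?_
    filter_upwards [eventually_abs_kernelMean_sub_sub_le hf one_pos, self_mem_nhdsWithin]
      with b hle (hb : 0 < b)
    rw [Real.norm_eq_abs, Real.norm_of_nonneg hb.le]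
    exact hle s hs
  have hdrift : (fun b => b * gTerm f s) =O[𝓝[>] 0] fun b : ℝ => b := by
    simpa only [mul_comm] using isBigO_const_mul_self (gTerm f s) (fun b : ℝ => b) (𝓝[>] 0)
  exact (hbias.add hdrift).congr_left fun b => by ring

lemma isBigO_kernelSqError_mul_kernelMean_sub (hf : ContDiffOn ℝ 2 f (simplex d))
    (hs : s ∈ simplexInt d) :
    (fun b => kernelSqError s b * kernelMean (b / 2) s f - f s) =O[𝓝[>] 0] fun b : ℝ => b := by
  have hlim : Tendsto (fun b : ℝ => b) (𝓝[>] 0) (𝓝 0) := tendsto_nhdsWithin_of_tendsto_nhds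
    tendsto_id
  have hhalf : Tendsto (fun b : ℝ => b / 2) (𝓝[>] 0) (𝓝[>] 0) := by
    refine tendsto_nhdsWithin_iff.2 ⟨by simpa using hlim.div_const 2, ?_⟩
    filter_upwards [self_mem_nhdsWithin] with b (hb : 0 < b)
    exact half_pos hb
  have hmean : (fun b => kernelMean (b / 2) s f - f s) =O[𝓝[>] 0] fun b : ℝ => b := by
    refine ((isBigO_kernelMean_sub hf hs).comp_tendsto hhalf).trans ?_
    simpa [div_eq_inv_mul, Function.comp_def] using
      isBigO_const_mul_self (2⁻¹ : ℝ) (fun b : ℝ => b) (𝓝[>] 0)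
  have hmean_one : (fun b => kernelMean (b / 2) s f) =O[𝓝[>] 0] fun _ => (1 : ℝ) := by
    simpa using (hmean.trans (hlim.isBigO_one ℝ)).add (isBigO_const_const (f s) one_ne_zero _)
  have hmul : (fun b => (kernelSqError s b - 1) * kernelMean (b / 2) s f) =O[𝓝[>] 0]
      fun b : ℝ => b := by
    simpa using (isBigO_kernelSqError_sub_one hs).mul hmean_one
  exact (hmul.add hmean).congr_left fun b => by ring

lemma isBigO_id_rpow_half : (fun b : ℝ => b) =O[𝓝[>] 0] fun b : ℝ => b ^ (1 / 2 : ℝ) := by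
  refine IsBigO.of_bound 1 ?_
  filter_upwards [Ioo_mem_nhdsGT one_pos] with b hb
  rw [one_mul, Real.norm_of_nonneg hb.1.le, Real.norm_of_nonneg (Real.rpow_nonneg hb.1.le _)]
  simpa using Real.rpow_le_rpow_of_exponent_ge hb.1 hb.2.le (by norm_num : (1 / 2 : ℝ) ≤ 1)

lemma isBigO_integral_kernel_sq_mul_sub (hf : ContDiffOn ℝ 2 f (simplex d))
    (hs : s ∈ simplexInt d) :
    (fun b => (∫ x in simplex d, kernel b s x ^ 2 * f x) - b ^ (-(d : ℝ) / 2) * (psi s * f s))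
      =O[𝓝[>] 0] fun b : ℝ => b ^ (-(d : ℝ) / 2 + 1 / 2) := by
  have hscaled := ((isBigO_refl (fun b : ℝ => b ^ (-(d : ℝ) / 2)) (𝓝[>] 0)).mul
    ((isBigO_kernelSqError_mul_kernelMean_sub hf hs).trans isBigO_id_rpow_half)).const_mul_left
    (psi s)
  refine hscaled.congr' ?_ ?_ <;> filter_upwards [self_mem_nhdsWithin] with b (hb : 0 < b)
  · rw [integral_kernel_sq_mul hs hb]
    ring
  · rw [Real.rpow_add hb]

end KernelSquare

section SampleMean

variable {n : ℕ} {Ω : Type*} [MeasurableSpace Ω] {P : Measure Ω} {Y : Fin n → Ω → ℝ}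

lemma integral_sampleMean (hn : 0 < n) (hY : ∀ i, Integrable (Y i) P) {m : ℝ}
    (hm : ∀ i, ∫ ω, Y i ω ∂P = m) : ∫ ω, 1 / (n : ℝ) * ∑ i, Y i ω ∂P = m := by
  rw [integral_const_mul, integral_finsetSum _ fun i _ => hY i,
    Finset.sum_congr rfl fun i _ => hm i, Fin.sum_const, nsmul_eq_mul]
  field_simp

lemma variance_sampleMean (hn : 0 < n) (hY : ∀ i, MemLp (Y i) 2 P)
    (hindep : Pairwise fun i j => IndepFun (Y i) (Y j) P) {v : ℝ}
    (hv : ∀ i, variance (Y i) P = v) :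
    variance (fun ω => 1 / (n : ℝ) * ∑ i, Y i ω) P = (n : ℝ)⁻¹ * v := by
  have hsum : variance (fun ω => ∑ i, Y i ω) P = n * v := by
    rw [← Finset.sum_fn, IndepFun.variance_sum (fun i _ => hY i) fun i _ j _ hij => hindep hij,
      Finset.sum_congr rfl fun i _ => hv i, Fin.sum_const, nsmul_eq_mul]
  rw [variance_const_mul, hsum]
  field_simp

lemma integral_abs_sub_sq [IsProbabilityMeasure P] {Z : Ω → ℝ} (hZ : MemLp Z 2 P) (c : ℝ) :
    ∫ ω, |Z ω - c| ^ 2 ∂P = variance Z P + ((∫ ω, Z ω ∂P) - c) ^ 2 := by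
  have hvar := variance_eq_sub (X := fun ω => Z ω - c) (hZ.sub (memLp_const c))
  rw [variance_sub_const hZ.1, integral_sub (hZ.integrable one_le_two) (integrable_const c)] at hvar
  simp [hvar, sq_abs]

end SampleMean

section Sampling

variable {d n : ℕ} {f : (Fin d → ℝ) → ℝ} {s : Fin d → ℝ} {b : ℝ}

@[fun_prop]
lemma measurable_kernel (b : ℝ) (s : Fin d → ℝ) : Measurable (kernel b s) :=
  measurable_dirichletDensity _ _

lemma integral_simplexLaw (hf : IsSimplexDensity f) (h : (Fin d → ℝ) → ℝ) :
    ∫ x, h x ∂(simplexLaw f) = ∫ x in simplex d, h x * f x := by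
  rw [simplexLaw, integral_withDensity_eq_integral_toReal_smul₀
    hf.integrableOn.aemeasurable.ennreal_ofReal (ae_of_all _ fun _ => ENNReal.ofReal_lt_top)]
  refine setIntegral_congr_fun (measurableSet_simplex d) fun x hx => ?_
  simp only [ENNReal.toReal_ofReal (hf.nonneg x hx), smul_eq_mul, mul_comm]

lemma ae_simplexLaw_mem (f : (Fin d → ℝ) → ℝ) : ∀ᵐ x ∂(simplexLaw f), x ∈ simplex d :=
  (withDensity_absolutelyContinuous _ _).ae_le (ae_restrict_mem (measurableSet_simplex d))

lemma dirichletDensity_le_dirichletConst {α : Fin d → ℝ} {β : ℝ} {x : Fin d → ℝ}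
    (hα : ∀ i, 1 ≤ α i) (hβ : 1 ≤ β) (hx : x ∈ simplex d) :
    dirichletDensity α β x ≤ dirichletConst α β := by
  have hconst := dirichletConst_pos (fun i => one_pos.trans_le (hα i)) (one_pos.trans_le hβ)
  have hpow_nonneg : ∀ i, 0 ≤ x i ^ (α i - 1) := fun i =>
    Real.rpow_nonneg (nonneg_of_mem_simplex hx i) _
  have hpow_le : ∀ i, x i ^ (α i - 1) ≤ 1 := fun i =>
    Real.rpow_le_one (hx.1 i).1 (hx.1 i).2 (sub_nonneg.2 (hα i))
  have hweight_le : (1 - l1Norm x) ^ (β - 1) ≤ 1 := Real.rpow_le_one (sub_nonneg.2 hx.2)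
    (by linarith [l1Norm_nonneg x]) (sub_nonneg.2 hβ)
  exact mul_le_of_le_one_right hconst.le (mul_le_one₀ hweight_le
    (Finset.prod_nonneg fun i _ => hpow_nonneg i)
    (Finset.prod_le_one (fun i _ => hpow_nonneg i) fun i _ => hpow_le i))

lemma exists_abs_kernel_le (hs : s ∈ simplex d) (hb : 0 < b) :
    ∃ C, ∀ x ∈ simplex d, |kernel b s x| ≤ C := by
  refine ⟨dirichletConst (fun i => s i / b + 1) ((1 - l1Norm s) / b + 1), fun x hx => ?_⟩
  rw [kernel,
    abs_of_nonneg (dirichletDensity_nonneg (kernel_alpha_pos hs hb) (kernel_beta_pos hs hb) hx)]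
  exact dirichletDensity_le_dirichletConst
    (fun i => le_add_of_nonneg_left (div_nonneg (nonneg_of_mem_simplex hs i) hb.le))
    (le_add_of_nonneg_left (div_nonneg (sub_nonneg.2 hs.2) hb.le)) hx

/-- The mean squared error at `s` of the estimator built on a sample of size `n` from `f`, written
in terms of `f` alone. -/
noncomputable def sampleMSE (f : (Fin d → ℝ) → ℝ) (s : Fin d → ℝ) (n : ℕ) (b : ℝ) : ℝ :=
  (n : ℝ)⁻¹ * ((∫ x in simplex d, kernel b s x ^ 2 * f x) - kernelMean b s f ^ 2) +
    (kernelMean b s f - f s) ^ 2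

variable {Ω : Type*} [MeasurableSpace Ω] {P : Measure Ω} {X : Fin n → Ω → (Fin d → ℝ)}

lemma integral_comp_sample (hf : IsSimplexDensity f) (hX : IsSample P f X)
    {h : (Fin d → ℝ) → ℝ} (hh : Measurable h) (i : Fin n) :
    ∫ ω, h (X i ω) ∂P = ∫ x in simplex d, h x * f x :=
  ((hX.hasLaw i).integral_comp hh.aestronglyMeasurable).trans (integral_simplexLaw hf h)

variable [IsProbabilityMeasure P]

lemma memLp_kernel_comp (hX : IsSample P f X) (hs : s ∈ simplex d) (hb : 0 < b) (i : Fin n) :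
    MemLp (fun ω => kernel b s (X i ω)) 2 P := by
  obtain ⟨C, hC⟩ := exists_abs_kernel_le hs hb
  have hlaw := hX.hasLaw i
  have : IsProbabilityMeasure (simplexLaw f) := hlaw.isProbabilityMeasure_iff.1 inferInstance
  have hkernel : MemLp (kernel b s) 2 (simplexLaw f) :=
    MemLp.of_bound (measurable_kernel b s).aestronglyMeasurable C ((ae_simplexLaw_mem f).mono hC)
  rw [← hlaw.map_eq] at hkernel
  exact hkernel.comp_of_map hlaw.aemeasurable

lemma memLp_estimator (hX : IsSample P f X) (hs : s ∈ simplex d) (hb : 0 < b) :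
    MemLp (estimator X b s) 2 P :=
  (memLp_finsetSum _ fun i _ => memLp_kernel_comp hX hs hb i).const_mul _

lemma integral_estimator (hn : 0 < n) (hf : IsSimplexDensity f) (hX : IsSample P f X)
    (hs : s ∈ simplex d) (hb : 0 < b) :
    ∫ ω, estimator X b s ω ∂P = kernelMean b s f :=
  integral_sampleMean hn (fun i => (memLp_kernel_comp hX hs hb i).integrable one_le_two)
    fun i => integral_comp_sample hf hX (measurable_kernel b s) i

lemma variance_estimator (hn : 0 < n) (hf : IsSimplexDensity f) (hX : IsSample P f X)
    (hs : s ∈ simplex d) (hb : 0 < b) :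
    variance (estimator X b s) P = (n : ℝ)⁻¹ *
      ((∫ x in simplex d, kernel b s x ^ 2 * f x) - kernelMean b s f ^ 2) := by
  have hkernel := measurable_kernel b s
  refine variance_sampleMean hn (fun i => memLp_kernel_comp hX hs hb i)
    (fun i j hij => (hX.indep.indepFun hij).comp hkernel hkernel) fun i => ?_
  rw [variance_eq_sub (memLp_kernel_comp hX hs hb i), integral_comp_sample hf hX hkernel]
  exact congrArg (· - _) (integral_comp_sample hf hX (hkernel.pow_const 2) i)

lemma meanSquaredError_eq_variance_add (hX : IsSample P f X) (hs : s ∈ simplex d) (hb : 0 < b) :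
    meanSquaredError P f X b s = variance (estimator X b s) P + bias P f X b s ^ 2 :=
  integral_abs_sub_sq (memLp_estimator hX hs hb) _

lemma meanSquaredError_eq_sampleMSE (hn : 0 < n) (hf : IsSimplexDensity f) (hX : IsSample P f X)
    (hs : s ∈ simplex d) (hb : 0 < b) :
    meanSquaredError P f X b s = sampleMSE f s n b := by
  rw [meanSquaredError_eq_variance_add hX hs hb, bias, integral_estimator hn hf hX hs hb,
    variance_estimator hn hf hX hs hb, sampleMSE]

end Sampling

section Remainders

variable {d : ℕ} {f : (Fin d → ℝ) → ℝ} {s : Fin d → ℝ}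

/-- The difference between the variance of the estimator and its leading part
`n⁻¹ b^{-d/2} ψ(s) f(s)`, at `p = (n, b)`. -/
noncomputable def varianceRemainder (f : (Fin d → ℝ) → ℝ) (s : Fin d → ℝ) (p : ℕ × ℝ) : ℝ :=
  (p.1 : ℝ)⁻¹ * ((∫ x in simplex d, kernel p.2 s x ^ 2 * f x) -
    p.2 ^ (-(d : ℝ) / 2) * (psi s * f s) - kernelMean p.2 s f ^ 2)

/-- The difference between the squared bias of the estimator and its leading part `b² g(s)²`, at
`p = (n, b)`. -/
noncomputable def sqBiasRemainder (f : (Fin d → ℝ) → ℝ) (s : Fin d → ℝ) (p : ℕ × ℝ) : ℝ :=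
  (kernelMean p.2 s f - f s) ^ 2 - p.2 ^ 2 * gTerm f s ^ 2

lemma sampleMSE_eq (f : (Fin d → ℝ) → ℝ) (s : Fin d → ℝ) (n : ℕ) (b : ℝ) :
    sampleMSE f s n b = leadingMSE f s n b + varianceRemainder f s (n, b) +
      sqBiasRemainder f s (n, b) := by
  simp only [sampleMSE, leadingMSE, varianceRemainder, sqBiasRemainder]
  ring

lemma isBigO_one_rpow_nhdsGT {a : ℝ} (ha : a ≤ 0) :
    (fun _ : ℝ => (1 : ℝ)) =O[𝓝[>] 0] fun b : ℝ => b ^ a := by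
  refine IsBigO.of_bound 1 ?_
  filter_upwards [Ioo_mem_nhdsGT one_pos] with b hb
  rw [one_mul, norm_one, Real.norm_of_nonneg (Real.rpow_nonneg hb.1.le _)]
  exact Real.one_le_rpow_of_pos_of_le_one_of_nonpos hb.1 hb.2.le ha

lemma isBigO_varianceRemainder (hd : 0 < d) (hf : ContDiffOn ℝ 2 f (simplex d))
    (hs : s ∈ simplexInt d) :
    varianceRemainder f s =O[atTop ×ˢ 𝓝[>] (0 : ℝ)]
      fun p => (p.1 : ℝ)⁻¹ * p.2 ^ (-(d : ℝ) / 2 + 1 / 2) := by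
  have hid : (fun b : ℝ => b) =O[𝓝[>] 0] fun _ => (1 : ℝ) :=
    (tendsto_nhdsWithin_of_tendsto_nhds tendsto_id).isBigO_one ℝ
  have hmean : (fun b => kernelMean b s f) =O[𝓝[>] 0] fun _ => (1 : ℝ) := by
    simpa using ((isBigO_kernelMean_sub hf hs).trans hid).add
      (isBigO_const_const (f s) one_ne_zero _)
  have hexponent : -(d : ℝ) / 2 + 1 / 2 ≤ 0 := by
    linarith [(Nat.one_le_cast (α := ℝ)).2 hd]
  have hmean_sq : (fun b => kernelMean b s f ^ 2) =O[𝓝[>] 0]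
      fun b : ℝ => b ^ (-(d : ℝ) / 2 + 1 / 2) :=
    IsBigO.trans (by simpa using hmean.pow 2) (isBigO_one_rpow_nhdsGT hexponent)
  exact (isBigO_refl (fun p : ℕ × ℝ => (p.1 : ℝ)⁻¹) _).mul
    (((isBigO_integral_kernel_sq_mul_sub hf hs).sub hmean_sq).comp_tendsto tendsto_snd)

lemma eventually_abs_sq_sub_sq_le {κ ι : Type*} {S : Set κ} {l : Filter ι} {u : κ → ι → ℝ}
    {g : κ → ℝ} {t : ι → ℝ} {G : ℝ} (hG : 0 ≤ G) (hg : ∀ k ∈ S, |g k| ≤ G)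
    (ht : ∀ᶠ p in l, 0 ≤ t p)
    (hu : ∀ ε : ℝ, 0 < ε → ∀ᶠ p in l, ∀ k ∈ S, |u k p - t p * g k| ≤ ε * t p)
    {ε : ℝ} (hε : 0 < ε) :
    ∀ᶠ p in l, ∀ k ∈ S, |u k p ^ 2 - t p ^ 2 * g k ^ 2| ≤ ε * t p ^ 2 := by
  set η := min 1 (ε / (1 + 2 * G))
  filter_upwards [hu η (by positivity), ht] with p hp htp k hk
  have hdiff := hp k hk
  have hsum : |u k p + t p * g k| ≤ t p * (1 + 2 * G) := by
    calc |u k p + t p * g k| = |(u k p - t p * g k) + 2 * (t p * g k)| := by ring_nf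
      _ ≤ η * t p + 2 * (t p * G) := by
          refine (abs_add_le _ _).trans (add_le_add hdiff ?_)
          rw [abs_mul, abs_mul, abs_of_nonneg htp, abs_two]
          gcongr
          exact hg k hk
      _ ≤ 1 * t p + 2 * (t p * G) := by gcongr; exact min_le_left _ _
      _ = t p * (1 + 2 * G) := by ring
  calc |u k p ^ 2 - t p ^ 2 * g k ^ 2| = |u k p - t p * g k| * |u k p + t p * g k| := by
        rw [← abs_mul]
        ring_nf
    _ ≤ η * t p * (t p * (1 + 2 * G)) := by gcongr
    _ = η * (1 + 2 * G) * t p ^ 2 := by ring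
    _ ≤ ε * t p ^ 2 := by
        gcongr
        exact (le_div_iff₀ (by positivity)).1 (min_le_right 1 (ε / (1 + 2 * G)))

lemma eventually_abs_sqBiasRemainder_le (hf : ContDiffOn ℝ 2 f (simplex d)) {ε : ℝ} (hε : 0 < ε) :
    ∀ᶠ p : ℕ × ℝ in atTop ×ˢ 𝓝[>] (0 : ℝ),
      ∀ s ∈ simplexInt d, |sqBiasRemainder f s p| ≤ ε * p.2 ^ 2 := by
  obtain ⟨G, hG, hg⟩ := exists_abs_gTerm_le hf
  have hpos : ∀ᶠ b : ℝ in 𝓝[>] 0, 0 ≤ b := by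
    filter_upwards [self_mem_nhdsWithin] with b (hb : 0 < b)
    exact hb.le
  exact tendsto_snd.eventually (eventually_abs_sq_sub_sq_le hG hg hpos
    (fun η hη => eventually_abs_kernelMean_sub_sub_le hf hη) hε)

lemma isLittleO_sqBiasRemainder (hf : ContDiffOn ℝ 2 f (simplex d)) (hs : s ∈ simplexInt d) :
    sqBiasRemainder f s =o[atTop ×ˢ 𝓝[>] (0 : ℝ)] fun p : ℕ × ℝ => p.2 ^ 2 := by
  refine isLittleO_iff.2 fun ε hε => ?_
  filter_upwards [eventually_abs_sqBiasRemainder_le hf hε] with p hp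
  rw [Real.norm_eq_abs, Real.norm_of_nonneg (sq_nonneg _)]
  exact hp s hs

end Remainders

section RiskProfile

/-- The risk profile `b ↦ b^{-D/2} A + b² G`. The leading part of the mean squared error in
dimension `D` is the profile with variance coefficient `A = n⁻¹ ψ(s) f(s)` and squared bias
coefficient `G = g(s)²`. -/
noncomputable def riskProfile (D A G b : ℝ) : ℝ := b ^ (-D / 2) * A + b ^ 2 * G

variable {D A G : ℝ}

lemma riskProfile_pos (hA : 0 < A) (hG : 0 < G) {b : ℝ} (hb : 0 < b) : 0 < riskProfile D A G b := by
  unfold riskProfile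
  positivity

lemma riskProfile_inv_mul (hD : 0 < D) {t b : ℝ} (ht : 0 < t) (hb : 0 < b) :
    riskProfile D (t⁻¹ * A) G b =
      t ^ (-4 / (D + 4)) * riskProfile D A G (t ^ (2 / (D + 4)) * b) := by
  have hvariance : t ^ (-4 / (D + 4)) * (t ^ (2 / (D + 4))) ^ (-D / 2) = t⁻¹ := by
    rw [← Real.rpow_mul ht.le, ← Real.rpow_add ht, ← Real.rpow_neg_one]
    congr 1
    field_simp
    ring
  have hsq : t ^ (-4 / (D + 4)) * (t ^ (2 / (D + 4))) ^ 2 = 1 := by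
    rw [← Real.rpow_mul_natCast ht.le, ← Real.rpow_add ht, ← Real.rpow_zero t]
    congr 1
    field_simp
    norm_num
  rw [riskProfile, riskProfile, Real.mul_rpow (by positivity) hb.le]
  linear_combination (-(b ^ (-D / 2) * A)) * hvariance - b ^ 2 * G * hsq

lemma continuousAt_riskProfile (D A G : ℝ) {b : ℝ} (hb : 0 < b) :
    ContinuousAt (riskProfile D A G) b :=
  ((Real.continuousAt_rpow_const b (-D / 2) (Or.inl hb.ne')).mul_const A).add
    ((continuousAt_id.pow 2).mul_const G)

lemma min_mul_riskProfile_one_le {b : ℝ} (hb : 0 < b) {t : ℝ} (ht : 0 ≤ t) :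
    min A G * riskProfile D (t * 1) 1 b ≤ riskProfile D (t * A) G b := by
  calc min A G * riskProfile D (t * 1) 1 b
      = b ^ (-D / 2) * (t * min A G) + b ^ 2 * min A G := by rw [riskProfile]; ring
    _ ≤ riskProfile D (t * A) G b := by
      rw [riskProfile]
      gcongr
      exacts [min_le_left _ _, min_le_right _ _]

lemma one_sub_mul_sub_one_lt_rpow_neg {a v : ℝ} (ha : 0 < a) (hv : 0 < v) (hv1 : v ≠ 1) :
    1 - a * (v - 1) < v ^ (-a) := by
  calc 1 - a * (v - 1) < Real.log v * -a + 1 := by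
        linarith [mul_lt_mul_of_pos_left (Real.log_lt_sub_one_of_pos hv hv1) ha]
    _ ≤ v ^ (-a) := (Real.add_one_le_exp _).trans_eq (Real.rpow_def_of_pos hv _).symm

/-- With `v = (b / b₀)²` the profile is `b₀^{-D/2} A · (v^{-D/4} + (D/4) v)`, so that the claim is
Bernoulli's inequality for the exponent `-D/4`. -/
lemma riskProfile_lt_of_critical (hD : 0 < D) (hA : 0 < A) {b₀ b : ℝ} (hb₀ : 0 < b₀)
    (hb : 0 < b) (hne : b ≠ b₀) (hcrit : b₀ ^ 2 * G = D / 4 * (b₀ ^ (-D / 2) * A)) :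
    riskProfile D A G b₀ < riskProfile D A G b := by
  obtain ⟨r, rfl⟩ : ∃ r, b = b₀ * r := ⟨b / b₀, (mul_div_cancel₀ _ hb₀.ne').symm⟩
  have hr : 0 < r := pos_of_mul_pos_right hb hb₀.le
  have hsq_ne : r ^ 2 ≠ 1 := fun h =>
    hne (by rw [(pow_eq_one_iff_of_nonneg hr.le two_ne_zero).1 h, mul_one])
  have hpow : r ^ (-D / 2) = (r ^ 2) ^ (-(D / 4)) := by
    rw [← Real.rpow_natCast_mul hr.le]
    congr 1
    push_cast
    ring
  calc riskProfile D A G b₀ = b₀ ^ (-D / 2) * A * (1 + D / 4) := by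
        rw [riskProfile, hcrit]
        ring
    _ < b₀ ^ (-D / 2) * A * ((r ^ 2) ^ (-(D / 4)) + D / 4 * r ^ 2) := by
        have := one_sub_mul_sub_one_lt_rpow_neg (by positivity : 0 < D / 4)
          (by positivity : 0 < r ^ 2) hsq_ne
        exact mul_lt_mul_of_pos_left (by linarith) (by positivity)
    _ = riskProfile D A G (b₀ * r) := by
        rw [riskProfile, Real.mul_rpow hb₀.le hr.le, hpow]
        linear_combination (-r ^ 2) * hcrit

/-- The minimiser of the risk profile. -/
noncomputable def optScale (D A G : ℝ) : ℝ := (D / 4 * (A / G)) ^ (2 / (D + 4))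

lemma optScale_pos (hD : 0 < D) (hA : 0 < A) (hG : 0 < G) : 0 < optScale D A G := by
  unfold optScale
  positivity

lemma optScale_sq_mul (hD : 0 < D) (hA : 0 < A) (hG : 0 < G) :
    optScale D A G ^ 2 * G = D / 4 * (optScale D A G ^ (-D / 2) * A) := by
  have hpow : optScale D A G ^ ((D + 4) / 2) = D / 4 * (A / G) := by
    rw [optScale, ← Real.rpow_mul (by positivity)]
    convert Real.rpow_one _ using 2
    field_simp
  have hsplit : optScale D A G ^ 2 =
      optScale D A G ^ (-D / 2) * optScale D A G ^ ((D + 4) / 2) := by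
    rw [← Real.rpow_add (optScale_pos hD hA hG), ← Real.rpow_two]
    congr 1
    ring
  rw [hsplit, hpow]
  field_simp

lemma riskProfile_optScale_lt (hD : 0 < D) (hA : 0 < A) (hG : 0 < G) {b : ℝ} (hb : 0 < b)
    (hne : b ≠ optScale D A G) : riskProfile D A G (optScale D A G) < riskProfile D A G b :=
  riskProfile_lt_of_critical hD hA (optScale_pos hD hA hG) hb hne (optScale_sq_mul hD hA hG)

lemma riskProfile_optScale (hD : 0 < D) (hA : 0 < A) (hG : 0 < G) :
    riskProfile D A G (optScale D A G) =
      (1 + D / 4) / (D / 4) ^ (D / (D + 4)) * (A ^ (4 / (D + 4)) / G ^ (-D / (D + 4))) := by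
  have hA_pow : A ^ (-D / (D + 4)) * A = A ^ (4 / (D + 4)) := by
    rw [← Real.rpow_add_one hA.ne']
    congr 1
    field_simp
    ring
  have hvariance : optScale D A G ^ (-D / 2) * A =
      ((D / 4) ^ (D / (D + 4)))⁻¹ * (A ^ (4 / (D + 4)) / G ^ (-D / (D + 4))) := by
    rw [optScale, ← Real.rpow_mul (by positivity), ← Real.rpow_neg (by positivity), ← neg_div,
      show 2 / (D + 4) * (-D / 2) = -D / (D + 4) by field_simp,
      Real.mul_rpow (by positivity) (by positivity), Real.div_rpow hA.le hG.le, ← hA_pow]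
    ring
  rw [riskProfile, optScale_sq_mul hD hA hG, hvariance]
  ring

end RiskProfile

section CriticalBandwidth

variable {D : ℝ}

lemma tendsto_prodMk_of_critical (hD : 0 < D) {b : ℕ → ℝ} {lam : ℝ}
    (hb : ∀ᶠ n in atTop, 0 < b n)
    (h : Tendsto (fun n : ℕ => (n : ℝ) ^ (2 / (D + 4)) * b n) atTop (𝓝 lam)) :
    Tendsto (fun n => (n, b n)) atTop (atTop ×ˢ 𝓝[>] (0 : ℝ)) := by
  refine tendsto_id.prodMk (tendsto_nhdsWithin_iff.2 ⟨?_, hb⟩)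
  have hdecay : Tendsto (fun n : ℕ => (n : ℝ) ^ (-(2 / (D + 4)))) atTop (𝓝 0) :=
    (tendsto_rpow_neg_atTop (by positivity)).comp tendsto_natCast_atTop_atTop
  have hprod := hdecay.mul h
  rw [zero_mul] at hprod
  refine hprod.congr' ?_
  filter_upwards [eventually_gt_atTop 0] with n hn
  rw [Real.rpow_neg n.cast_nonneg, inv_mul_cancel_left₀ (by positivity)]

lemma isLittleO_riskProfile_sub_of_critical (hD : 0 < D) (A G : ℝ) {b : ℕ → ℝ} {lam : ℝ}
    (hb : ∀ᶠ n in atTop, 0 < b n) (hlam : 0 < lam)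
    (h : Tendsto (fun n : ℕ => (n : ℝ) ^ (2 / (D + 4)) * b n) atTop (𝓝 lam)) :
    (fun n : ℕ => riskProfile D ((n : ℝ)⁻¹ * A) G (b n) -
        (n : ℝ) ^ (-4 / (D + 4)) * riskProfile D A G lam)
      =o[atTop] fun n : ℕ => (n : ℝ) ^ (-4 / (D + 4)) := by
  have hlim : Tendsto (fun n : ℕ => riskProfile D A G ((n : ℝ) ^ (2 / (D + 4)) * b n) -
      riskProfile D A G lam) atTop (𝓝 0) :=
    tendsto_sub_nhds_zero_iff.2 ((continuousAt_riskProfile D A G hlam).tendsto.comp h)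
  refine ((isBigO_refl _ _).mul_isLittleO ((isLittleO_one_iff ℝ).2 hlim)).congr' ?_
    (Eventually.of_forall fun n => mul_one _)
  filter_upwards [hb, eventually_gt_atTop 0] with n hbn hn
  rw [riskProfile_inv_mul hD (Nat.cast_pos.2 hn) hbn]
  ring

lemma isBigO_riskProfile_of_critical (hD : 0 < D) (A G : ℝ) {b : ℕ → ℝ} {lam : ℝ}
    (hb : ∀ᶠ n in atTop, 0 < b n) (hlam : 0 < lam)
    (h : Tendsto (fun n : ℕ => (n : ℝ) ^ (2 / (D + 4)) * b n) atTop (𝓝 lam)) :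
    (fun n : ℕ => riskProfile D ((n : ℝ)⁻¹ * A) G (b n))
      =O[atTop] fun n : ℕ => (n : ℝ) ^ (-4 / (D + 4)) := by
  simpa only [mul_comm (riskProfile D A G lam), sub_add_cancel] using
    (isLittleO_riskProfile_sub_of_critical hD A G hb hlam h).isBigO.add
      (isBigO_const_mul_self (riskProfile D A G lam) (fun n : ℕ => (n : ℝ) ^ (-4 / (D + 4))) atTop)

end CriticalBandwidth

lemma one_sub_mul_le_of_abs_sub_le {m₁ m₂ L₁ L₂ η ε : ℝ} (hη1 : η ≤ 1) (hηε : η ≤ ε)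
    (hL₁ : 0 ≤ L₁) (hL : L₁ ≤ L₂) (h₁ : |m₁ - L₁| ≤ η / 2 * L₁) (h₂ : |m₂ - L₂| ≤ η / 2 * L₂) :
    (1 - ε) * m₁ ≤ m₂ := by
  rw [abs_le] at h₁ h₂
  have hm₁ : 0 ≤ m₁ := by nlinarith
  calc (1 - ε) * m₁ ≤ (1 - η) * m₁ := by gcongr
    _ ≤ (1 - η) * ((1 + η / 2) * L₁) := mul_le_mul_of_nonneg_left (by linarith) (by linarith)
    _ ≤ (1 - η / 2) * L₁ := by nlinarith [mul_nonneg (sq_nonneg η) hL₁]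
    _ ≤ (1 - η / 2) * L₂ := mul_le_mul_of_nonneg_left hL (by linarith)
    _ ≤ m₂ := by linarith

section OptimalBandwidth

variable {d : ℕ} {f : (Fin d → ℝ) → ℝ} {s : Fin d → ℝ}

lemma leadingMSE_eq_riskProfile (f : (Fin d → ℝ) → ℝ) (s : Fin d → ℝ) (n : ℕ) (b : ℝ) :
    leadingMSE f s n b = riskProfile d ((n : ℝ)⁻¹ * (psi s * f s)) (gTerm f s ^ 2) b := by
  rw [leadingMSE, riskProfile]
  ring

lemma isLittleO_varianceRemainder (hd : 0 < d) (hf : ContDiffOn ℝ 2 f (simplex d))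
    (hs : s ∈ simplexInt d) :
    varianceRemainder f s =o[atTop ×ˢ 𝓝[>] (0 : ℝ)]
      fun p => (p.1 : ℝ)⁻¹ * p.2 ^ (-(d : ℝ) / 2) := by
  have hroot : Tendsto (fun p : ℕ × ℝ => p.2 ^ (1 / 2 : ℝ)) (atTop ×ˢ 𝓝[>] (0 : ℝ)) (𝓝 0) := by
    have hlim := (Real.continuousAt_rpow_const 0 (1 / 2) (Or.inr (by norm_num))).tendsto
    rw [Real.zero_rpow (by norm_num)] at hlim
    exact (tendsto_nhdsWithin_of_tendsto_nhds hlim).comp tendsto_snd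
  refine (isBigO_varianceRemainder hd hf hs).trans_isLittleO
    (((isBigO_refl _ _).mul_isLittleO ((isLittleO_one_iff ℝ).2 hroot)).congr' ?_
      (Eventually.of_forall fun p => mul_one _))
  filter_upwards [tendsto_snd.eventually self_mem_nhdsWithin] with p (hp : 0 < p.2)
  rw [Real.rpow_add hp, mul_assoc]

lemma isLittleO_sampleMSE_sub_leadingMSE (hd : 0 < d) (hf : ContDiffOn ℝ 2 f (simplex d))
    (hs : s ∈ simplexInt d) :
    (fun p : ℕ × ℝ => sampleMSE f s p.1 p.2 - leadingMSE f s p.1 p.2)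
      =o[atTop ×ˢ 𝓝[>] (0 : ℝ)] fun p => riskProfile d ((p.1 : ℝ)⁻¹ * 1) 1 p.2 := by
  have hpos : ∀ᶠ p : ℕ × ℝ in atTop ×ˢ 𝓝[>] (0 : ℝ), 0 < p.2 :=
    tendsto_snd.eventually self_mem_nhdsWithin
  have hvariance : (fun p : ℕ × ℝ => (p.1 : ℝ)⁻¹ * p.2 ^ (-(d : ℝ) / 2))
      =O[atTop ×ˢ 𝓝[>] (0 : ℝ)] fun p => riskProfile d ((p.1 : ℝ)⁻¹ * 1) 1 p.2 := by
    refine IsBigO.of_bound 1 (hpos.mono fun p hp => ?_)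
    rw [one_mul, riskProfile, Real.norm_of_nonneg (by positivity),
      Real.norm_of_nonneg (by positivity)]
    linarith [sq_nonneg p.2]
  have hsq : (fun p : ℕ × ℝ => p.2 ^ 2)
      =O[atTop ×ˢ 𝓝[>] (0 : ℝ)] fun p => riskProfile d ((p.1 : ℝ)⁻¹ * 1) 1 p.2 := by
    refine IsBigO.of_bound 1 (hpos.mono fun p hp => ?_)
    rw [one_mul, riskProfile, Real.norm_of_nonneg (by positivity),
      Real.norm_of_nonneg (by positivity), mul_one (p.2 ^ 2)]
    exact le_add_of_nonneg_left (by positivity)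
  refine (((isLittleO_varianceRemainder hd hf hs).trans_isBigO hvariance).add
    ((isLittleO_sqBiasRemainder hf hs).trans_isBigO hsq)).congr_left fun p => ?_
  rw [sampleMSE_eq]
  ring

lemma isLittleO_sampleMSE_sub_of_critical (hd : 0 < d) (hf : ContDiffOn ℝ 2 f (simplex d))
    (hs : s ∈ simplexInt d) {b : ℕ → ℝ} {lam : ℝ} (hb : ∀ᶠ n in atTop, 0 < b n) (hlam : 0 < lam)
    (h : Tendsto (fun n : ℕ => (n : ℝ) ^ (2 / ((d : ℝ) + 4)) * b n) atTop (𝓝 lam)) :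
    (fun n : ℕ => sampleMSE f s n (b n) -
        (n : ℝ) ^ (-4 / ((d : ℝ) + 4)) * riskProfile d (psi s * f s) (gTerm f s ^ 2) lam)
      =o[atTop] fun n : ℕ => (n : ℝ) ^ (-4 / ((d : ℝ) + 4)) := by
  have hd' : (0 : ℝ) < d := Nat.cast_pos.2 hd
  have hremainder := ((isLittleO_sampleMSE_sub_leadingMSE hd hf hs).comp_tendsto
    (tendsto_prodMk_of_critical hd' hb h)).trans_isBigO
      (isBigO_riskProfile_of_critical hd' 1 1 hb hlam h)
  refine (hremainder.add (isLittleO_riskProfile_sub_of_critical hd' (psi s * f s) (gTerm f s ^ 2)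
    hb hlam h)).congr_left fun n => ?_
  simp only [Function.comp_apply, leadingMSE_eq_riskProfile]
  ring

lemma bOpt_eq (f : (Fin d → ℝ) → ℝ) (s : Fin d → ℝ) (n : ℕ) :
    bOpt f s n =
      (n : ℝ) ^ (-2 / ((d : ℝ) + 4)) * optScale d (psi s * f s) (gTerm f s ^ 2) := rfl

lemma rpow_mul_bOpt {n : ℕ} (hn : 0 < n) :
    (n : ℝ) ^ (2 / ((d : ℝ) + 4)) * bOpt f s n = optScale d (psi s * f s) (gTerm f s ^ 2) := by
  rw [bOpt_eq, neg_div, Real.rpow_neg n.cast_nonneg, mul_inv_cancel_left₀ (by positivity)]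

lemma tendsto_rpow_mul_bOpt (f : (Fin d → ℝ) → ℝ) (s : Fin d → ℝ) :
    Tendsto (fun n : ℕ => (n : ℝ) ^ (2 / ((d : ℝ) + 4)) * bOpt f s n) atTop
      (𝓝 (optScale d (psi s * f s) (gTerm f s ^ 2))) :=
  tendsto_const_nhds.congr' ((eventually_gt_atTop 0).mono fun _ hn => (rpow_mul_bOpt hn).symm)

lemma bOpt_pos (hd : 0 < d) (hA : 0 < psi s * f s) (hG : 0 < gTerm f s ^ 2) {n : ℕ} (hn : 0 < n) :
    0 < bOpt f s n :=
  mul_pos (Real.rpow_pos_of_pos (Nat.cast_pos.2 hn) _) (optScale_pos (Nat.cast_pos.2 hd) hA hG)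

lemma leadingMSE_bOpt_lt (hd : 0 < d) (hA : 0 < psi s * f s) (hG : 0 < gTerm f s ^ 2) {n : ℕ}
    (hn : 0 < n) {b : ℝ} (hb : 0 < b) (hne : b ≠ bOpt f s n) :
    leadingMSE f s n (bOpt f s n) < leadingMSE f s n b := by
  have hd' : (0 : ℝ) < d := Nat.cast_pos.2 hd
  have hn' : (0 : ℝ) < n := Nat.cast_pos.2 hn
  simp only [leadingMSE_eq_riskProfile]
  rw [riskProfile_inv_mul hd' hn' (bOpt_pos hd hA hG hn), riskProfile_inv_mul hd' hn' hb,
    rpow_mul_bOpt hn]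
  gcongr
  refine riskProfile_optScale_lt hd' hA hG (by positivity) fun h => hne ?_
  rw [← rpow_mul_bOpt hn] at h
  exact mul_left_cancel₀ (by positivity) h

lemma isLittleO_sampleMSE_sub_leadingMSE_of_pos (hd : 0 < d) (hA : 0 < psi s * f s)
    (hG : 0 < gTerm f s ^ 2) (hf : ContDiffOn ℝ 2 f (simplex d)) (hs : s ∈ simplexInt d) :
    (fun p : ℕ × ℝ => sampleMSE f s p.1 p.2 - leadingMSE f s p.1 p.2)
      =o[atTop ×ˢ 𝓝[>] (0 : ℝ)] fun p => leadingMSE f s p.1 p.2 := by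
  refine (isLittleO_sampleMSE_sub_leadingMSE hd hf hs).trans_isBigO
    (IsBigO.of_bound (min (psi s * f s) (gTerm f s ^ 2))⁻¹ ?_)
  filter_upwards [tendsto_snd.eventually self_mem_nhdsWithin,
    tendsto_fst.eventually (eventually_gt_atTop 0)] with p (hb : 0 < p.2) hn
  have hn' : (0 : ℝ) < p.1 := Nat.cast_pos.2 hn
  rw [leadingMSE_eq_riskProfile,
    Real.norm_of_nonneg (riskProfile_pos (by positivity) one_pos hb).le,
    Real.norm_of_nonneg (riskProfile_pos (by positivity) hG hb).le, le_inv_mul_iff₀ (lt_min hA hG)]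
  exact min_mul_riskProfile_one_le hb (inv_nonneg.2 hn'.le)

lemma eventually_sampleMSE_bOpt_le (hd : 0 < d) (hA : 0 < psi s * f s) (hG : 0 < gTerm f s ^ 2)
    (hf : ContDiffOn ℝ 2 f (simplex d)) (hs : s ∈ simplexInt d) {ε : ℝ} (hε : 0 < ε) :
    ∀ᶠ p : ℕ × ℝ in atTop ×ˢ 𝓝[>] (0 : ℝ),
      (1 - ε) * sampleMSE f s p.1 (bOpt f s p.1) ≤ sampleMSE f s p.1 p.2 := by
  have hbOpt : ∀ᶠ n : ℕ in atTop, 0 < bOpt f s n :=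
    (eventually_gt_atTop 0).mono fun _ hn => bOpt_pos hd hA hG hn
  have hη : 0 < min ε 1 := lt_min hε one_pos
  have hclose := isLittleO_iff.1 (isLittleO_sampleMSE_sub_leadingMSE_of_pos hd hA hG hf hs)
    (half_pos hη)
  have hclose_opt := (tendsto_prodMk_of_critical (Nat.cast_pos.2 hd) hbOpt
    (tendsto_rpow_mul_bOpt f s)).eventually hclose
  filter_upwards [hclose, tendsto_snd.eventually self_mem_nhdsWithin,
    tendsto_fst.eventually hclose_opt, tendsto_fst.eventually (eventually_gt_atTop 0)]
    with p hp (hb : 0 < p.2) hp_opt hn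
  have hle : leadingMSE f s p.1 (bOpt f s p.1) ≤ leadingMSE f s p.1 p.2 := by
    rcases eq_or_ne p.2 (bOpt f s p.1) with h | h
    · rw [h]
    · exact (leadingMSE_bOpt_lt hd hA hG hn hb h).le
  have hpos : 0 ≤ leadingMSE f s p.1 (bOpt f s p.1) := by
    have := bOpt_pos hd hA hG hn
    unfold leadingMSE
    positivity
  rw [Real.norm_eq_abs, Real.norm_of_nonneg hpos] at hp_opt
  rw [Real.norm_eq_abs, Real.norm_of_nonneg (hpos.trans hle)] at hp
  exact one_sub_mul_le_of_abs_sub_le (min_le_right _ _) (min_le_left _ _) hpos hle hp_opt hp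

lemma isLittleO_sampleMSE_bOpt_sub (hd : 0 < d) (hA : 0 < psi s * f s) (hG : 0 < gTerm f s ^ 2)
    (hf : ContDiffOn ℝ 2 f (simplex d)) (hs : s ∈ simplexInt d) :
    (fun n : ℕ => sampleMSE f s n (bOpt f s n) - (n : ℝ) ^ (-4 / ((d : ℝ) + 4)) *
        ((1 + (d : ℝ) / 4) / ((d : ℝ) / 4) ^ ((d : ℝ) / ((d : ℝ) + 4))) *
        ((psi s * f s) ^ (4 / ((d : ℝ) + 4)) / (gTerm f s ^ 2) ^ (-(d : ℝ) / ((d : ℝ) + 4))))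
      =o[atTop] fun n : ℕ => (n : ℝ) ^ (-4 / ((d : ℝ) + 4)) := by
  have hd' : (0 : ℝ) < d := Nat.cast_pos.2 hd
  have h := isLittleO_sampleMSE_sub_of_critical hd hf hs
    ((eventually_gt_atTop 0).mono fun _ hn => bOpt_pos hd hA hG hn) (optScale_pos hd' hA hG)
    (tendsto_rpow_mul_bOpt f s)
  simpa only [riskProfile_optScale hd' hA hG, ← mul_assoc] using h

end OptimalBandwidth

end DirichletKernel

theorem mainTheorem6 {d : ℕ} (hd : 0 < d) (f : (Fin d → ℝ) → ℝ)
    (hf : DirichletKernel.IsSimplexDensity f)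
    (hf2 : ContDiffOn ℝ 2 f (DirichletKernel.simplex d)) :
    -- `mse s n b` is the common value, for all samples of size `n` from `f`, of `MSE[f̂_{n,b}(s)]`
    ∃ mse : (Fin d → ℝ) → ℕ → ℝ → ℝ,
      (∀ (Ω : Type*) [MeasurableSpace Ω] (P : Measure Ω) [IsProbabilityMeasure P]
        (n : ℕ) (X : Fin n → Ω → (Fin d → ℝ)) (b : ℝ),
        0 < n → 0 < b → DirichletKernel.IsSample P f X →
          ∀ s ∈ DirichletKernel.simplexInt d,
            MemLp (DirichletKernel.estimator X b s) 2 P ∧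
            DirichletKernel.meanSquaredError P f X b s = mse s n b ∧
            DirichletKernel.meanSquaredError P f X b s =
              variance (DirichletKernel.estimator X b s) P +
                DirichletKernel.bias P f X b s ^ 2) ∧
      -- the expansion as `n → ∞` and `b → 0`: the first remainder is bounded locally in `s`,
      -- the second one is small uniformly in `s`
      (∃ R₁ R₂ : (Fin d → ℝ) → ℕ × ℝ → ℝ,
        (∀ s ∈ DirichletKernel.simplexInt d,
          R₁ s =O[atTop ×ˢ 𝓝[>] (0 : ℝ)]
            fun p => (p.1 : ℝ)⁻¹ * p.2 ^ (-(d : ℝ) / 2 + 1 / 2)) ∧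
        (∀ ε : ℝ, 0 < ε → ∀ᶠ p : ℕ × ℝ in atTop ×ˢ 𝓝[>] (0 : ℝ),
          ∀ s ∈ DirichletKernel.simplexInt d, |R₂ s p| ≤ ε * p.2 ^ 2) ∧
        ∀ s ∈ DirichletKernel.simplexInt d, ∀ (n : ℕ) (b : ℝ), 0 < n → 0 < b →
          mse s n b =
            (n : ℝ)⁻¹ * b ^ (-(d : ℝ) / 2) * (DirichletKernel.psi s * f s)
              + b ^ 2 * DirichletKernel.gTerm f s ^ 2 + R₁ s (n, b) + R₂ s (n, b)) ∧
      -- the optimal bandwidth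
      (∀ s ∈ DirichletKernel.simplexInt d, f s * DirichletKernel.gTerm f s ≠ 0 →
        (∀ n : ℕ, 0 < n → 0 < DirichletKernel.bOpt f s n ∧
          ∀ b : ℝ, 0 < b → b ≠ DirichletKernel.bOpt f s n →
            DirichletKernel.leadingMSE f s n (DirichletKernel.bOpt f s n) <
              DirichletKernel.leadingMSE f s n b) ∧
        (∀ ε : ℝ, 0 < ε → ∀ᶠ p : ℕ × ℝ in atTop ×ˢ 𝓝[>] (0 : ℝ),
          (1 - ε) * mse s p.1 (DirichletKernel.bOpt f s p.1) ≤ mse s p.1 p.2) ∧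
        ((fun n : ℕ => mse s n (DirichletKernel.bOpt f s n) -
            (n : ℝ) ^ (-4 / ((d : ℝ) + 4)) *
              ((1 + (d : ℝ) / 4) / ((d : ℝ) / 4) ^ ((d : ℝ) / ((d : ℝ) + 4))) *
              ((DirichletKernel.psi s * f s) ^ (4 / ((d : ℝ) + 4)) /
                (DirichletKernel.gTerm f s ^ 2) ^ (-(d : ℝ) / ((d : ℝ) + 4))))
          =o[atTop] fun n : ℕ => (n : ℝ) ^ (-4 / ((d : ℝ) + 4)))) ∧
      -- bandwidths with `n^{2/(d+4)} b → lam`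
      (∀ s ∈ DirichletKernel.simplexInt d,
        ∀ (b : ℕ → ℝ) (lam : ℝ), (∀ n, 0 < b n) → 0 < lam →
        Tendsto (fun n : ℕ => (n : ℝ) ^ (2 / ((d : ℝ) + 4)) * b n) atTop (𝓝 lam) →
        (fun n : ℕ => mse s n (b n) -
            (n : ℝ) ^ (-4 / ((d : ℝ) + 4)) *
              (lam ^ (-(d : ℝ) / 2) * (DirichletKernel.psi s * f s) +
                lam ^ 2 * DirichletKernel.gTerm f s ^ 2))
          =o[atTop] fun n : ℕ => (n : ℝ) ^ (-4 / ((d : ℝ) + 4))) := by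
  have hsub {s : Fin d → ℝ} (hs : s ∈ DirichletKernel.simplexInt d) :=
    DirichletKernel.simplexInt_subset_simplex d hs
  refine ⟨DirichletKernel.sampleMSE f, ?_, ⟨DirichletKernel.varianceRemainder f,
    DirichletKernel.sqBiasRemainder f, ?_, ?_, ?_⟩, ?_, ?_⟩
  · intro Ω _ P _ n X b hn hb hX s hs
    exact ⟨DirichletKernel.memLp_estimator hX (hsub hs) hb,
      DirichletKernel.meanSquaredError_eq_sampleMSE hn hf hX (hsub hs) hb,
      DirichletKernel.meanSquaredError_eq_variance_add hX (hsub hs) hb⟩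
  · exact fun s hs => DirichletKernel.isBigO_varianceRemainder hd hf2 hs
  · exact fun ε hε => DirichletKernel.eventually_abs_sqBiasRemainder_le hf2 hε
  · exact fun s _ n b _ _ => DirichletKernel.sampleMSE_eq f s n b
  · intro s hs hfg
    have hfs : 0 < f s := (hf.nonneg s (hsub hs)).lt_of_ne' (left_ne_zero_of_mul hfg)
    have hA := mul_pos (DirichletKernel.psi_pos hs) hfs
    have hG := sq_pos_of_ne_zero (right_ne_zero_of_mul hfg)
    exact ⟨fun n hn => ⟨DirichletKernel.bOpt_pos hd hA hG hn,
        fun b => DirichletKernel.leadingMSE_bOpt_lt hd hA hG hn⟩,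
      fun ε hε => DirichletKernel.eventually_sampleMSE_bOpt_le hd hA hG hf2 hs hε,
      DirichletKernel.isLittleO_sampleMSE_bOpt_sub hd hA hG hf2 hs⟩
  · intro s hs b lam hb hlam h
    exact DirichletKernel.isLittleO_sampleMSE_sub_of_critical hd hf2 hs
      (Eventually.of_forall hb) hlam h
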